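/- Theorem 3.4. Let $\Omega\subseteq\mathbb C$ be open with $0\in\Omega$ and such that $(\mathbb C\cup\{\infty\})\setminus\overline\Omega$ is connected, where $\overline\Omega$ is the closure of $\Omega$ in $\mathbb C$. Let $A^\infty(\Omega)$ be the set of holomorphic functions $f$ on $\Omega$ such that for every $l=0,1,2,\dots$ the derivative $f^{(l)}$ extends continuously to $\overline\Omega$ (the extension is again denoted $f^{(l)}$), with the metric $$\rho(f,g)=\sum_{l=0}^\infty\sum_{n=1}^\infty\frac1{2^{l+n}}\min\Big\{\sup_{z\in\overline\Omega,\ |z|\le n}|f^{(l)}(z)-g^{(l)}(z)|,\,1\Big\}.$$ Let $H(\overline\Omega)\subseteq A^\infty(\Omega)$ be the set of (restrictions to $\Omega$ of) functions holomorphic in some open set containing $\overline\Omega$, and let $X$ be its closure in $(A^\infty(\Omega),\rho)$. For $f$ holomorphic near $0$ with Taylor series $\sum_{v\ge0}a_vz^v$, and $p,q\in\{0,1,2,\dots\}$, write $f\in D_{p,q}$ if $\det\big(a_{p-q+1+i+j}\big)_{0\le i,j<q}\ne0$, where $a_i=0$ for $i<0$ and the empty determinant ($q=0$) is $1$. For $f\in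 D_{p,q}$ let $[p/q]_f=N/D$ be the unique rational function with polynomials $N,D$ satisfying $\deg N\le p$, $\deg D\le q$, $D(0)=1$, whose Taylor coefficients at $0$ of index $0,\dots,p+q$ are $a_0,\dots,a_{p+q}$. Let $F\subseteq\{0,1,2,\dots\}^2$ contain a sequence $(\tilde p_m,\tilde q_m)_{m\in\mathbb N}$ with $\tilde p_m\to+\infty$, and let $B_F$ be the set of $f\in A^\infty(\Omega)$ for which there is a sequence $(p_m,q_m)_{m\in\mathbb N}$ in $F$ such that $f\in D_{p_m,q_m}$ for all $m$ and, for every compact $K\subseteq\overline\Omega$ and every $l=0,1,2,\dots$, $[p_m/q_m]_f^{(l)}\to f^{(l)}$ uniformly on $K$ (in particular, $[p_m/q_m]_f$ has no poles in $K$ for all large $m$). Then $B_F\cap X$ is a $G_\delta$ subset of $X$ and is dense in $X$. In particular $B_F\neq\emptyset$. -/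

import Mathlib

open Set Filter Topology Polynomial

noncomputable section

namespace PadeSmooth

/-- The space `A^∞(Ω)`: holomorphic functions on `Ω` all of whose derivatives extend continuously
to the closure of `Ω`. A function on `Ω` is recorded by its extension by zero to `ℂ`, so that
two elements are equal exactly when they agree on `Ω`; the values off `Ω` carry no information. -/
@[ext]
structure AInf (Ω : Set ℂ) where
  toFun : ℂ → ℂ
  zero_off : ∀ z, z ∉ Ω → toFun z = 0
  holomorphic : DifferentiableOn ℂ toFun Ω
  extends_closure : ∀ l : ℕ, ∃ g : ℂ → ℂ,
    ContinuousOn g (closure Ω) ∧ EqOn g (iteratedDeriv l toFun) Ω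

variable {Ω : Set ℂ}

/-- The `l`-th derivative of `f`, extended by continuity from `Ω` to the closure of `Ω`
(only its values on `closure Ω` are meaningful). -/
def AInf.extDeriv (f : AInf Ω) (l : ℕ) : ℂ → ℂ :=
  extendFrom Ω (iteratedDeriv l f.toFun)

/-- `‖f - g‖_{l,n}`, the supremum of `|f^{(l)} - g^{(l)}|` over `closure Ω ∩ {|z| ≤ n}`. -/
def AInf.seminormDist (f g : AInf Ω) (l n : ℕ) : ℝ :=
  ⨆ z : ↥(closure Ω ∩ Metric.closedBall (0 : ℂ) n), ‖f.extDeriv l z - g.extDeriv l z‖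

/-- The metric `ρ(f,g) = ∑_{l ≥ 0} ∑_{n ≥ 1} 2^{-(l+n)} min(‖f-g‖_{l,n}, 1)`;
the inner sum is indexed by `k = n - 1`. -/
def AInf.rho (f g : AInf Ω) : ℝ :=
  ∑' l : ℕ, ∑' k : ℕ, 1 / 2 ^ (l + (k + 1)) * min (f.seminormDist g l (k + 1)) 1

theorem AInf.extDeriv_continuousOn_eqOn (f : AInf Ω) (l : ℕ) :
    ContinuousOn (f.extDeriv l) (closure Ω) ∧ EqOn (f.extDeriv l) (iteratedDeriv l f.toFun) Ω := by
  obtain ⟨g, hg, hgf⟩ := f.extends_closure l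
  have key : EqOn (f.extDeriv l) g (closure Ω) := by
    intro z hz
    refine extendFrom_eq hz ?_
    refine Tendsto.congr' ?_ ((hg z hz).mono_left (nhdsWithin_mono z subset_closure))
    filter_upwards [self_mem_nhdsWithin] with w hw using hgf hw
  exact ⟨hg.congr key, fun z hz => (key (subset_closure hz)).trans (hgf hz)⟩

theorem AInf.bddAbove_seminormDist (f g : AInf Ω) (l n : ℕ) :
    BddAbove (range fun z : ↥(closure Ω ∩ Metric.closedBall (0 : ℂ) n) =>
      ‖f.extDeriv l z - g.extDeriv l z‖) := by
  have hK : IsCompact (closure Ω ∩ Metric.closedBall (0 : ℂ) n) :=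
    (isCompact_closedBall (0 : ℂ) n).inter_left isClosed_closure
  have hc : ContinuousOn (fun z => ‖f.extDeriv l z - g.extDeriv l z‖)
      (closure Ω ∩ Metric.closedBall (0 : ℂ) n) :=
    (((f.extDeriv_continuousOn_eqOn l).1.sub (g.extDeriv_continuousOn_eqOn l).1).norm).mono
      inter_subset_left
  have := (hK.image_of_continuousOn hc).bddAbove
  rwa [image_eq_range] at this

theorem AInf.seminormDist_nonneg (f g : AInf Ω) (l n : ℕ) : 0 ≤ f.seminormDist g l n :=
  Real.iSup_nonneg fun _ => norm_nonneg _

theorem AInf.seminormDist_triangle (f g h : AInf Ω) (l n : ℕ) :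
    f.seminormDist h l n ≤ f.seminormDist g l n + g.seminormDist h l n := by
  refine Real.iSup_le (fun z => ?_)
    (add_nonneg (f.seminormDist_nonneg g l n) (g.seminormDist_nonneg h l n))
  have h1 := le_ciSup (f.bddAbove_seminormDist g l n) z
  have h2 := le_ciSup (g.bddAbove_seminormDist h l n) z
  exact (norm_sub_le_norm_sub_add_norm_sub _ (g.extDeriv l z) _).trans (add_le_add h1 h2)

theorem AInf.rho_term_nonneg (f g : AInf Ω) (l k : ℕ) :
    0 ≤ 1 / 2 ^ (l + (k + 1)) * min (f.seminormDist g l (k + 1)) 1 :=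
  mul_nonneg (by positivity) (le_min (f.seminormDist_nonneg g _ _) zero_le_one)

theorem AInf.rho_term_le (f g : AInf Ω) (l k : ℕ) :
    1 / 2 ^ (l + (k + 1)) * min (f.seminormDist g l (k + 1)) 1
      ≤ (1 / 2 : ℝ) ^ l * ((1 / 2) ^ k * (1 / 2)) := by
  calc _ ≤ 1 / 2 ^ (l + (k + 1)) * (1 : ℝ) := by gcongr; exact min_le_right _ _
    _ = _ := by rw [mul_one, pow_add, pow_succ]; simp [one_div]; ring

theorem AInf.rho_inner_summable (f g : AInf Ω) (l : ℕ) :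
    Summable fun k : ℕ => 1 / 2 ^ (l + (k + 1)) * min (f.seminormDist g l (k + 1)) 1 :=
  Summable.of_nonneg_of_le (f.rho_term_nonneg g l) (f.rho_term_le g l)
    ((summable_geometric_two.mul_right _).mul_left _)

theorem AInf.rho_outer_summable (f g : AInf Ω) :
    Summable fun l : ℕ =>
      ∑' k : ℕ, 1 / 2 ^ (l + (k + 1)) * min (f.seminormDist g l (k + 1)) 1 := by
  refine Summable.of_nonneg_of_le (fun l => tsum_nonneg (f.rho_term_nonneg g l))
    (fun l => (f.rho_inner_summable g l).tsum_le_tsum (f.rho_term_le g l)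
      ((summable_geometric_two.mul_right _).mul_left _)) ?_
  simp only [tsum_mul_left]
  exact summable_geometric_two.mul_right _

/-- `A^∞(Ω)` is equipped with the metric `ρ`. -/
instance : MetricSpace (AInf Ω) where
  dist := AInf.rho
  dist_self f := by simp [AInf.rho, AInf.seminormDist]
  dist_comm f g := by simp only [AInf.rho, AInf.seminormDist, norm_sub_rev]
  dist_triangle f g h := by
    change f.rho h ≤ f.rho g + g.rho h
    unfold AInf.rho
    rw [← (f.rho_outer_summable g).tsum_add (g.rho_outer_summable h)]
    refine (f.rho_outer_summable h).tsum_le_tsum (fun l => ?_)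
      ((f.rho_outer_summable g).add (g.rho_outer_summable h))
    rw [← (f.rho_inner_summable g l).tsum_add (g.rho_inner_summable h l)]
    refine (f.rho_inner_summable h l).tsum_le_tsum (fun k => ?_)
      ((f.rho_inner_summable g l).add (g.rho_inner_summable h l))
    rw [← mul_add]
    refine mul_le_mul_of_nonneg_left ?_ (by positivity)
    have h1 := f.seminormDist_triangle g h l (k + 1)
    have h2 := f.seminormDist_nonneg g l (k + 1)
    have h3 := g.seminormDist_nonneg h l (k + 1)
    grind
  eq_of_dist_eq_zero := by
    intro f g hfg
    change (∑' l : ℕ, ∑' k : ℕ, 1 / 2 ^ (l + (k + 1)) *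
      min (f.seminormDist g l (k + 1)) 1) = 0 at hfg
    have h1 := (hasSum_zero_iff_of_nonneg fun l => tsum_nonneg (f.rho_term_nonneg g l)).1
      (hfg ▸ (f.rho_outer_summable g).hasSum)
    have h2 : ∀ k, 1 / 2 ^ (0 + (k + 1)) * min (f.seminormDist g 0 (k + 1)) 1 = 0 := by
      have := (hasSum_zero_iff_of_nonneg (f.rho_term_nonneg g 0)).1
        ((congrFun h1 0) ▸ (f.rho_inner_summable g 0).hasSum)
      exact fun k => congrFun this k
    ext z
    by_cases hz : z ∈ Ω
    · obtain ⟨k, hk⟩ := exists_nat_ge ‖z‖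
      have h3 : f.seminormDist g 0 (k + 1) = 0 := by
        have h4 : min (f.seminormDist g 0 (k + 1)) 1 = 0 :=
          (mul_eq_zero.1 (h2 k)).resolve_left (by positivity)
        grind
      have hzK : z ∈ closure Ω ∩ Metric.closedBall (0 : ℂ) ((k + 1 : ℕ) : ℝ) :=
        ⟨subset_closure hz, by rw [mem_closedBall_zero_iff]; push_cast; linarith⟩
      have h5 := le_ciSup (f.bddAbove_seminormDist g 0 (k + 1)) ⟨z, hzK⟩
      have h6 : ‖f.extDeriv 0 z - g.extDeriv 0 z‖ ≤ 0 := h5.trans h3.le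
      have h7 := sub_eq_zero.1 (norm_le_zero_iff.1 h6)
      rw [(f.extDeriv_continuousOn_eqOn 0).2 hz, (g.extDeriv_continuousOn_eqOn 0).2 hz] at h7
      simpa using h7
    · rw [f.zero_off z hz, g.zero_off z hz]

/-- `H(closure Ω)` inside `A^∞(Ω)`: the restrictions to `Ω` of the functions that are holomorphic
in some open set containing the closure of `Ω`. -/
def HClosure (Ω : Set ℂ) : Set (AInf Ω) :=
  {f | ∃ (U : Set ℂ) (h : ℂ → ℂ), IsOpen U ∧ closure Ω ⊆ U ∧ DifferentiableOn ℂ h U ∧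
    EqOn f.toFun h Ω}

/-- The Taylor coefficients of `f` at `0`. -/
def taylorCoeff (f : ℂ → ℂ) (v : ℕ) : ℂ :=
  iteratedDeriv v f 0 / (Nat.factorial v : ℂ)

/-- The Taylor coefficients of `f` at `0` with the convention `a_i = 0` for `i < 0`. -/
def taylorCoeffInt (f : ℂ → ℂ) (i : ℤ) : ℂ :=
  if i < 0 then 0 else taylorCoeff f i.toNat

/-- `f ∈ D_{p,q}`: the `q × q` determinant with entries `a_{p-q+1+i+j}`, `0 ≤ i, j < q`, is not
zero. For `q = 0` the determinant is empty, equal to `1`, and every `f` is in `D_{p,0}`. -/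
def InD (f : ℂ → ℂ) (p q : ℕ) : Prop :=
  (Matrix.of fun i j : Fin q =>
    taylorCoeffInt f ((p : ℤ) - (q : ℤ) + 1 + (i : ℕ) + (j : ℕ))).det ≠ 0

/-- `N / D` is a Padé approximant of type `[p/q]` of `f`: `deg N ≤ p`, `deg D ≤ q`, the constant
term of `D` is `1`, and the Taylor series of `N / D` at `0` (the power series `N D⁻¹`) agrees
with that of `f` in the coefficients of index `0, …, p + q`. For `f ∈ D_{p,q}` there is exactly
one such pair `(N, D)`, and `N`, `D` have no common zero. -/
structure IsPade (f : ℂ → ℂ) (p q : ℕ) (N D : ℂ[X]) : Prop where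
  natDegree_num_le : N.natDegree ≤ p
  natDegree_den_le : D.natDegree ≤ q
  den_coeff_zero : D.coeff 0 = 1
  coeff_eq : ∀ v ≤ p + q,
    PowerSeries.coeff v ((N : PowerSeries ℂ) * (D : PowerSeries ℂ)⁻¹) = taylorCoeff f v

/-- The class `B_F`: those `f ∈ A^∞(Ω)` for which there is a sequence `(p_m, q_m)` in `F` with
`f ∈ D_{p_m,q_m}` for all `m` and `[p_m/q_m]_f^{(l)} → f^{(l)}` uniformly on `K`, for all compact
`K ⊆ closure Ω` and all `l`. The approximants are written `N m / D m`; uniform convergence on `K`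
includes that they have no pole in `K` for all large `m`. -/
def BF (Ω : Set ℂ) (F : Set (ℕ × ℕ)) : Set (AInf Ω) :=
  {f | ∃ (p q : ℕ → ℕ) (N D : ℕ → ℂ[X]),
    (∀ m, (p m, q m) ∈ F ∧ InD f.toFun (p m) (q m) ∧ IsPade f.toFun (p m) (q m) (N m) (D m)) ∧
    ∀ K ⊆ closure Ω, IsCompact K →
      (∀ᶠ m in atTop, ∀ z ∈ K, (D m).eval z ≠ 0) ∧
      ∀ l : ℕ, TendstoUniformlyOn
        (fun m => iteratedDeriv l fun z => (N m).eval z / (D m).eval z) (f.extDeriv l) atTop K}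

end PadeSmooth

end

/-! The proof is a Baire category argument. `AInf Ω` is complete for ρ, so its closed subset X is a
Baire space. By `BF_eq_iInter`, B_F is the intersection over s of the unions over (p,q) in F of the
sets `PadeNear Ω s p q`, which ask for accuracy better than 1/(s+1) on closure Ω ∩ {|z| ≤ s} for all
derivatives up to order s. Each union must be shown open, and dense in X.

Openness (`isOpen_padeNear`): on D_{p,q} the coefficients of the approximant are, by Cramer's rule,
rational functions of finitely many Taylor coefficients, hence continuous in f because 0 ∈ Ω. A
denominator without zeros on a compact set keeps this property under small perturbations, and
Cauchy's estimates carry closeness of values to derivatives.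

Density has two steps. Runge's theorem, where connectedness of the complement enters, makes
polynomials dense in H(closure Ω). Then a polynomial P ≠ 0 with deg P ≤ p is replaced by P · (∑_{k ≤
p+q} (εz)^k)^q, which agrees with P/(1-εz)^q through order p+q. For small ε ≠ 0 this fraction is
reduced and has denominator of exact degree q, so Kronecker's criterion (`IsPade.inD_of_isCoprime`)
puts the perturbed polynomial in D_{p,q}, with this fraction as approximant. Both tend to P with all
derivatives on compact sets as ε → 0. Only p must be large; q is arbitrary.

Runge's theorem comes from the Cauchy–Pompeiu formula: a cut-off of f is a superposition of Cauchy
kernels with poles in a compact set off K, and each kernel is a uniform limit of polynomials because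
its pole can be reached from infinity. Everything is done on a neighbourhood of K so that
derivatives follow from Cauchy's estimates. -/

noncomputable section

namespace PadeSmooth

/-! ### Topology and completeness of A^∞(Ω) -/

/-- Cauchy's estimate for the iterated derivatives of a difference. -/
theorem norm_iteratedDeriv_sub_le {f g : ℂ → ℂ} {V : Set ℂ} (hV : IsOpen V)
    (hf : DifferentiableOn ℂ f V) (hg : DifferentiableOn ℂ g V) {z : ℂ} {δ C : ℝ} (hδ : 0 < δ)
    (hz : Metric.closedBall z δ ⊆ V) (hC : ∀ w ∈ Metric.closedBall z δ, ‖f w - g w‖ ≤ C) (l : ℕ) :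
    ‖iteratedDeriv l f z - iteratedDeriv l g z‖ ≤ l.factorial * C / δ ^ l := by
  have hzV : z ∈ V := hz (Metric.mem_closedBall_self hδ.le)
  have hfz : ContDiffAt ℂ l f z := (hf.analyticAt (hV.mem_nhds hzV)).contDiffAt
  have hgz : ContDiffAt ℂ l g z := (hg.analyticAt (hV.mem_nhds hzV)).contDiffAt
  have h1 : iteratedDeriv l (f - g) z = iteratedDeriv l f z - iteratedDeriv l g z :=
    iteratedDeriv_sub hfz hgz
  rw [← h1]
  refine Complex.norm_iteratedDeriv_le_of_forall_mem_sphere_norm_le l hδ ?_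
    fun w hw => hC w (Metric.sphere_subset_closedBall hw)
  refine ((hf.sub hg).mono (?_ : closure (Metric.ball z δ) ⊆ V)).diffContOnCl
  exact Metric.closure_ball_subset_closedBall.trans hz

variable {Ω : Set ℂ}

theorem AInf.norm_extDeriv_sub_le (f g : AInf Ω) (l n : ℕ) {z : ℂ}
    (hz : z ∈ closure Ω ∩ Metric.closedBall (0 : ℂ) n) :
    ‖f.extDeriv l z - g.extDeriv l z‖ ≤ f.seminormDist g l n :=
  le_ciSup (f.bddAbove_seminormDist g l n) ⟨z, hz⟩

theorem AInf.seminormDist_le {f g : AInf Ω} {l n : ℕ} {C : ℝ} (hC : 0 ≤ C)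
    (h : ∀ z ∈ closure Ω ∩ Metric.closedBall (0 : ℂ) n, ‖f.extDeriv l z - g.extDeriv l z‖ ≤ C) :
    f.seminormDist g l n ≤ C :=
  Real.iSup_le (fun z => h z z.2) hC

theorem AInf.min_seminormDist_le (f g : AInf Ω) (l k : ℕ) :
    min (f.seminormDist g l (k + 1)) 1 ≤ 2 ^ (l + (k + 1)) * dist f g := by
  have h1 : 1 / 2 ^ (l + (k + 1)) * min (f.seminormDist g l (k + 1)) 1 ≤ dist f g :=
    ((f.rho_inner_summable g l).le_tsum k fun j _ => f.rho_term_nonneg g l j).trans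
      ((f.rho_outer_summable g).le_tsum l fun j _ => tsum_nonneg (f.rho_term_nonneg g j))
  have h2 : (0 : ℝ) < 2 ^ (l + (k + 1)) := by positivity
  rw [one_div, inv_mul_le_iff₀ h2] at h1
  exact h1

theorem AInf.seminormDist_mono (f g : AInf Ω) (l : ℕ) {m n : ℕ} (hmn : m ≤ n) :
    f.seminormDist g l m ≤ f.seminormDist g l n :=
  AInf.seminormDist_le (f.seminormDist_nonneg g l n) fun z hz =>
    f.norm_extDeriv_sub_le g l n
      ⟨hz.1, Metric.closedBall_subset_closedBall (by exact_mod_cast hmn) hz.2⟩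

/-- For ε ≤ 1 the truncation at 1 in ρ is harmless. The weight is that of radius n + 1 because ρ
only sees radii at least 1, whereas n = 0 is allowed here. -/
theorem AInf.seminormDist_lt {f g : AInf Ω} {l n : ℕ} {ε : ℝ} (hε1 : ε ≤ 1)
    (h : dist f g < ε / 2 ^ (l + (n + 1))) : f.seminormDist g l n < ε := by
  have h1 := f.min_seminormDist_le g l n
  have h2 : (0 : ℝ) < 2 ^ (l + (n + 1)) := by positivity
  rw [lt_div_iff₀ h2, mul_comm] at h
  have h3 := h1.trans_lt h
  rcases min_lt_iff.1 h3 with h4 | h4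
  · exact (f.seminormDist_mono g l n.le_succ).trans_lt h4
  · exact absurd h4 (not_lt.2 hε1)

theorem AInf.eventually_norm_extDeriv_sub_lt (f : AInf Ω) (l n : ℕ) {ε : ℝ} (hε : 0 < ε) :
    ∀ᶠ g in 𝓝 f, ∀ z ∈ closure Ω ∩ Metric.closedBall (0 : ℂ) n,
      ‖g.extDeriv l z - f.extDeriv l z‖ < ε := by
  have h0 : 0 < min ε 1 / 2 ^ (l + (n + 1)) := by positivity
  filter_upwards [Metric.ball_mem_nhds f h0] with g hg z hz
  exact (g.norm_extDeriv_sub_le f l n hz).trans_lt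
    ((AInf.seminormDist_lt (min_le_right _ _) hg).trans_le (min_le_left _ _))

/-- Dominated convergence for series, applied to the inner and then to the outer sum. -/
theorem AInf.tendsto_of_seminormDist {ι : Type*} {φ : Filter ι} {u : ι → AInf Ω} {f : AInf Ω}
    (h : ∀ l n : ℕ, Tendsto (fun i => (u i).seminormDist f l n) φ (𝓝 0)) : Tendsto u φ (𝓝 f) := by
  rw [tendsto_iff_dist_tendsto_zero]
  have hinner : ∀ l : ℕ, Tendsto (fun i => ∑' k : ℕ, 1 / 2 ^ (l + (k + 1)) *
      min ((u i).seminormDist f l (k + 1)) 1) φ (𝓝 (∑' _ : ℕ, (0 : ℝ))) := by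
    intro l
    refine tendsto_tsum_of_dominated_convergence
      (bound := fun k => (1 / 2 : ℝ) ^ l * ((1 / 2) ^ k * (1 / 2)))
      ((summable_geometric_two.mul_right _).mul_left _) (fun k => ?_)
      (Eventually.of_forall fun i k => ?_)
    · have h1 := ((h l (k + 1)).min (tendsto_const_nhds (x := (1 : ℝ)))).const_mul
        (1 / 2 ^ (l + (k + 1)))
      simpa using h1
    · rw [Real.norm_of_nonneg ((u i).rho_term_nonneg f l k)]
      exact (u i).rho_term_le f l k
  have houter : Tendsto (fun i => ∑' l : ℕ, ∑' k : ℕ, 1 / 2 ^ (l + (k + 1)) *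
      min ((u i).seminormDist f l (k + 1)) 1) φ (𝓝 (∑' _ : ℕ, ∑' _ : ℕ, (0 : ℝ))) := by
    refine tendsto_tsum_of_dominated_convergence
      (bound := fun l => ∑' k : ℕ, (1 / 2 : ℝ) ^ l * ((1 / 2) ^ k * (1 / 2))) ?_
      hinner (Eventually.of_forall fun i l => ?_)
    · simp only [tsum_mul_left]
      exact summable_geometric_two.mul_right _
    · rw [Real.norm_of_nonneg (tsum_nonneg ((u i).rho_term_nonneg f l))]
      exact ((u i).rho_inner_summable f l).tsum_le_tsum ((u i).rho_term_le f l)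
        ((summable_geometric_two.mul_right _).mul_left _)
  simp only [tsum_zero] at houter
  exact houter

theorem AInf.differentiableOn_iteratedDeriv (hΩ : IsOpen Ω) (f : AInf Ω) (l : ℕ) :
    DifferentiableOn ℂ (iteratedDeriv l f.toFun) Ω := by
  induction l with
  | zero => simpa using f.holomorphic
  | succ l ih => rw [iteratedDeriv_succ]; exact ih.deriv hΩ

/-- The limit of a uniformly convergent system of derivatives is an element of `A^∞(Ω)`. -/
theorem AInf.exists_tendsto (hΩ : IsOpen Ω) {u : ℕ → AInf Ω} {g : ℕ → ℂ → ℂ}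
    (h : ∀ l n : ℕ, TendstoUniformlyOn (fun m => (u m).extDeriv l) (g l) atTop
      (closure Ω ∩ Metric.closedBall (0 : ℂ) n)) : ∃ f, Tendsto u atTop (𝓝 f) := by
  classical
  have hloc : ∀ l, TendstoLocallyUniformlyOn (fun m => (u m).extDeriv l) (g l) atTop
      (closure Ω) := by
    intro l v hv z hz
    obtain ⟨n, hn⟩ := exists_nat_gt ‖z‖
    refine ⟨closure Ω ∩ Metric.closedBall 0 n, ?_, h l n v hv⟩
    refine inter_mem self_mem_nhdsWithin (mem_nhdsWithin_of_mem_nhds ?_)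
    refine mem_of_superset (Metric.isOpen_ball.mem_nhds (?_ : z ∈ Metric.ball (0 : ℂ) n))
      Metric.ball_subset_closedBall
    simpa using hn
  have hcont : ∀ l, ContinuousOn (g l) (closure Ω) := fun l =>
    (hloc l).continuousOn (Frequently.of_forall fun m => ((u m).extDeriv_continuousOn_eqOn l).1)
  have hder : ∀ l, TendstoLocallyUniformlyOn (fun m => iteratedDeriv l (u m).toFun) (g l) atTop Ω :=
    fun l => ((hloc l).mono subset_closure).congr
      fun m z hz => ((u m).extDeriv_continuousOn_eqOn l).2 hz
  have hdiff : ∀ l, DifferentiableOn ℂ (g l) Ω := fun l =>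
    (hder l).differentiableOn (Eventually.of_forall fun m =>
      (u m).differentiableOn_iteratedDeriv hΩ l) hΩ
  -- Weierstrass: locally uniform convergence on Ω passes to complex derivatives, so the limits g l
  -- are successive derivatives of g 0.
  have hiter : ∀ l, EqOn (g l) (iteratedDeriv l (Ω.indicator (g 0))) Ω := by
    intro l
    induction l with
    | zero => intro z hz; simp [hz]
    | succ l ih =>
      intro z hz
      have h1 := (hder l).deriv (Eventually.of_forall fun m =>
        (u m).differentiableOn_iteratedDeriv hΩ l) hΩ
      have h2 : Tendsto (fun m => iteratedDeriv (l + 1) (u m).toFun z) atTop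
          (𝓝 (deriv (g l) z)) := by
        simpa [iteratedDeriv_succ, Function.comp_def] using h1.tendsto_at hz
      rw [tendsto_nhds_unique ((hder (l + 1)).tendsto_at hz) h2, iteratedDeriv_succ]
      exact (ih.eventuallyEq_of_mem (hΩ.mem_nhds hz)).deriv_eq
  let f : AInf Ω :=
    { toFun := Ω.indicator (g 0)
      zero_off := fun z hz => by simp [hz]
      holomorphic := (hdiff 0).congr fun z hz => by simp [hz]
      extends_closure := fun l => ⟨g l, hcont l, hiter l⟩ }
  have hf : ∀ l, EqOn (f.extDeriv l) (g l) (closure Ω) := by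
    intro l
    have h1 : EqOn (f.extDeriv l) (g l) Ω := fun z hz =>
      ((f.extDeriv_continuousOn_eqOn l).2 hz).trans (hiter l hz).symm
    exact h1.of_subset_closure (f.extDeriv_continuousOn_eqOn l).1 (hcont l) subset_closure le_rfl
  refine ⟨f, AInf.tendsto_of_seminormDist fun l n => ?_⟩
  rw [Metric.tendsto_atTop]
  intro ε hε
  obtain ⟨M, hM⟩ := eventually_atTop.1 (Metric.tendstoUniformlyOn_iff.1 (h l n) (ε / 2) (half_pos hε))
  refine ⟨M, fun m hm => ?_⟩
  rw [Real.dist_0_eq_abs, abs_of_nonneg ((u m).seminormDist_nonneg f l n)]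
  refine (AInf.seminormDist_le (half_pos hε).le fun z hz => ?_).trans_lt (half_lt_self hε)
  rw [hf l hz.1, ← dist_eq_norm, dist_comm]
  exact (hM m hm z hz).le

theorem AInf.completeSpace (hΩ : IsOpen Ω) : CompleteSpace (AInf Ω) := by
  refine Metric.complete_of_cauchySeq_tendsto fun u hu => ?_
  have hunif : ∀ l n : ℕ, UniformCauchySeqOn (fun m => (u m).extDeriv l) atTop
      (closure Ω ∩ Metric.closedBall (0 : ℂ) n) := by
    intro l n
    rw [Metric.uniformCauchySeqOn_iff]
    intro ε hε
    obtain ⟨N, hN⟩ := Metric.cauchySeq_iff.1 hu (min ε 1 / 2 ^ (l + (n + 1))) (by positivity)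
    refine ⟨N, fun m hm k hk z hz => ?_⟩
    rw [dist_eq_norm]
    exact ((u m).norm_extDeriv_sub_le (u k) l n hz).trans_lt
      ((AInf.seminormDist_lt (min_le_right _ _) (hN m hm k hk)).trans_le (min_le_left _ _))
  have hpt : ∀ l : ℕ, ∀ z ∈ closure Ω, ∃ a, Tendsto (fun m => (u m).extDeriv l z) atTop (𝓝 a) := by
    intro l z hz
    obtain ⟨n, hn⟩ := exists_nat_ge ‖z‖
    exact cauchySeq_tendsto_of_complete
      ((hunif l n).cauchySeq (⟨hz, by simpa using hn⟩ : z ∈ closure Ω ∩ Metric.closedBall 0 n))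
  choose! g hg using hpt
  exact AInf.exists_tendsto hΩ fun l n =>
    (hunif l n).tendstoUniformlyOn_of_tendsto fun z hz => hg l z hz.1

/-! ### The Cauchy–Pompeiu formula -/

theorem integral_div_sq_add_sq {R : ℝ} (hR : 0 < R) :
    ∫ x in (-R)..R, R / (x ^ 2 + R ^ 2) = Real.pi / 2 := by
  have h1 : ∀ x ∈ uIcc (-R) R, HasDerivAt (fun x => Real.arctan (x / R)) (R / (x ^ 2 + R ^ 2)) x := by
    intro x _
    have h2 := (Real.hasDerivAt_arctan (x / R)).comp x ((hasDerivAt_id x).div_const R)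
    refine h2.congr_deriv ?_
    have : x ^ 2 + R ^ 2 ≠ 0 := by positivity
    field_simp
    ring
  have hc : Continuous fun x : ℝ => R / (x ^ 2 + R ^ 2) :=
    Continuous.div (by fun_prop) (by fun_prop) fun x => by positivity
  rw [intervalIntegral.integral_eq_sub_of_hasDerivAt h1 (hc.intervalIntegrable _ _), neg_div,
    div_self hR.ne', Real.arctan_neg, Real.arctan_one]
  ring

/-- The integral of `1 / ζ` over the boundary of a square centred at `0`. -/
theorem integral_boundary_square_inv {R : ℝ} (hR : 0 < R) :
    (∫ x in (-R)..R, ((x : ℂ) + (-R : ℝ) * Complex.I)⁻¹) -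
      (∫ x in (-R)..R, ((x : ℂ) + (R : ℝ) * Complex.I)⁻¹) +
      Complex.I • (∫ y in (-R)..R, (((R : ℝ) : ℂ) + y * Complex.I)⁻¹) -
      Complex.I • (∫ y in (-R)..R, (((-R : ℝ) : ℂ) + y * Complex.I)⁻¹) =
      2 * Real.pi * Complex.I := by
  have hne1 : ∀ (x s : ℝ), s ≠ 0 → (x : ℂ) + s * Complex.I ≠ 0 := by
    intro x s hs h
    have := congrArg Complex.im h
    simp at this
    exact hs this
  have hne2 : ∀ (s y : ℝ), s ≠ 0 → (s : ℂ) + y * Complex.I ≠ 0 := by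
    intro s y hs h
    have := congrArg Complex.re h
    simp at this
    exact hs this
  have hi1 : ∀ s : ℝ, s ≠ 0 → IntervalIntegrable (fun x : ℝ => ((x : ℂ) + s * Complex.I)⁻¹)
      MeasureTheory.volume (-R) R := fun s hs =>
    (Continuous.inv₀ (by fun_prop) fun x => hne1 x s hs).intervalIntegrable _ _
  have hi2 : ∀ s : ℝ, s ≠ 0 → IntervalIntegrable (fun y : ℝ => ((s : ℂ) + y * Complex.I)⁻¹)
      MeasureTheory.volume (-R) R := fun s hs =>
    (Continuous.inv₀ (by fun_prop) fun y => hne2 s y hs).intervalIntegrable _ _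
  have hR' : -R ≠ 0 := neg_ne_zero.2 hR.ne'
  have hint : ∫ x in (-R)..R, ((R / (x ^ 2 + R ^ 2) : ℝ) : ℂ) = ((Real.pi / 2 : ℝ) : ℂ) := by
    rw [intervalIntegral.integral_ofReal, integral_div_sq_add_sq hR]
  -- Opposite sides are paired: each difference is a constant multiple of R/(x² + R²), and each pair
  -- contributes πi.
  rw [← intervalIntegral.integral_sub (hi1 _ hR') (hi1 _ hR.ne'), add_sub_assoc, ← smul_sub,
    ← intervalIntegral.integral_sub (hi2 _ hR.ne') (hi2 _ hR')]
  have hI : Complex.I ^ 2 = -1 := Complex.I_sq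
  have e1 : ∀ x : ℝ, ((x : ℂ) + (-R : ℝ) * Complex.I)⁻¹ - ((x : ℂ) + (R : ℝ) * Complex.I)⁻¹ =
      2 * Complex.I * ((R / (x ^ 2 + R ^ 2) : ℝ) : ℂ) := by
    intro x
    have h1 := hne1 x (-R) hR'
    have h2 := hne1 x R hR.ne'
    have h3 : (x : ℂ) ^ 2 + (R : ℂ) ^ 2 ≠ 0 := by
      have : x ^ 2 + R ^ 2 ≠ 0 := by positivity
      exact_mod_cast this
    rw [inv_sub_inv h1 h2, Complex.ofReal_div, div_eq_iff (mul_ne_zero h1 h2)]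
    push_cast
    field_simp
    linear_combination (2 * (R : ℂ) ^ 3 * Complex.I) * hI
  have e2 : ∀ y : ℝ, (((R : ℝ) : ℂ) + y * Complex.I)⁻¹ - (((-R : ℝ) : ℂ) + y * Complex.I)⁻¹ =
      2 * ((R / (y ^ 2 + R ^ 2) : ℝ) : ℂ) := by
    intro x
    have h1 := hne2 R x hR.ne'
    have h2 := hne2 (-R) x hR'
    have h3 : (x : ℂ) ^ 2 + (R : ℂ) ^ 2 ≠ 0 := by
      have : x ^ 2 + R ^ 2 ≠ 0 := by positivity
      exact_mod_cast this
    rw [inv_sub_inv h1 h2, Complex.ofReal_div, div_eq_iff (mul_ne_zero h1 h2)]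
    push_cast
    field_simp
    linear_combination (-2 * (R : ℂ) * (x : ℂ) ^ 2) * hI
  simp only [e1, e2, intervalIntegral.integral_const_mul, hint]
  push_cast
  simp only [smul_eq_mul]
  ring

/-- `2i` times the Wirtinger derivative `∂g/∂z̄`. -/
def dbar (g : ℂ → ℂ) (ζ : ℂ) : ℂ := Complex.I * fderiv ℝ g ζ 1 - fderiv ℝ g ζ Complex.I

theorem dbar_eq_zero {g : ℂ → ℂ} {ζ : ℂ} (h : DifferentiableAt ℂ g ζ) : dbar g ζ = 0 := by
  have h1 : fderiv ℝ g ζ = (fderiv ℂ g ζ).restrictScalars ℝ :=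
    (h.hasFDerivAt.restrictScalars ℝ).fderiv
  have h2 : fderiv ℂ g ζ Complex.I = Complex.I * fderiv ℂ g ζ 1 := by
    rw [← smul_eq_mul, ← map_smul, smul_eq_mul, mul_one]
  simp [dbar, h1, h2]

theorem continuous_dbar {g : ℂ → ℂ} (hg : ContDiff ℝ 1 g) : Continuous (dbar g) := by
  have h := hg.continuous_fderiv one_ne_zero
  unfold dbar
  fun_prop

theorem tsupport_dbar_subset (g : ℂ → ℂ) : tsupport (dbar g) ⊆ tsupport g := by
  refine closure_minimal ?_ (isClosed_tsupport g)
  intro ζ hζ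
  by_contra h
  refine hζ ?_
  have : fderiv ℝ g ζ = 0 := by
    by_contra h2
    exact h (support_fderiv_subset ℝ h2)
  simp [dbar, this]

/-- The Cauchy–Pompeiu formula at `0`, over a square containing the support. -/
theorem cauchy_pompeiu_square {g : ℂ → ℂ} (hg : ContDiff ℝ 1 g) {R : ℝ} (hR : 0 < R)
    (hsupp : ∀ ζ, R ≤ ‖ζ‖ → g ζ = 0) (h0 : ∀ᶠ w in 𝓝 (0 : ℂ), DifferentiableAt ℂ g w) :
    ∫ x in (-R)..R, ∫ y in (-R)..R, dbar g (x + y * Complex.I) / ((x : ℂ) + y * Complex.I) =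
      -(2 * Real.pi * Complex.I) * g 0 := by
  -- Away from 0 this is the real derivative of (g ζ - g 0)/ζ. Its first summand is complex linear,
  -- so only the derivative of g survives in `hE`.
  set f' : ℂ → ℂ →L[ℝ] ℂ := fun ζ =>
    (g ζ - g 0) • ((-(ζ ^ 2)⁻¹) • (ContinuousLinearMap.id ℝ ℂ)) + ζ⁻¹ • fderiv ℝ g ζ with hf'
  have hE : ∀ ζ, Complex.I • f' ζ 1 - f' ζ Complex.I = dbar g ζ / ζ := by
    intro ζ
    simp [hf', dbar]
    ring
  -- Continuity holds even at 0, since `dbar g` vanishes near 0, where g is holomorphic.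
  have hcontE : Continuous fun ζ => dbar g ζ / ζ := by
    rw [continuous_iff_continuousAt]
    intro ζ
    by_cases hζ : ζ = 0
    · subst hζ
      have : (fun ζ => dbar g ζ / ζ) =ᶠ[𝓝 0] fun _ => 0 := by
        filter_upwards [h0] with w hw
        rw [dbar_eq_zero hw, zero_div]
      exact continuousAt_const.congr this.symm
    · exact (continuous_dbar hg).continuousAt.div continuousAt_id hζ
  have hslope : ∀ ζ, ζ ≠ 0 → dslope g 0 ζ = (g ζ - g 0) * ζ⁻¹ := by
    intro ζ hζ
    rw [dslope_of_ne _ hζ, slope_def_field, sub_zero, div_eq_mul_inv]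
  have hderiv : ∀ ζ, ζ ≠ 0 → HasFDerivAt (dslope g 0) (f' ζ) ζ := by
    intro ζ hζ
    have h1 : HasFDerivAt (fun ζ => g ζ - g 0) (fderiv ℝ g ζ) ζ :=
      ((hg.differentiable one_ne_zero).differentiableAt.hasFDerivAt).sub_const _
    have h2 : HasFDerivAt (fun ζ : ℂ => ζ⁻¹) ((-(ζ ^ 2)⁻¹) • (ContinuousLinearMap.id ℝ ℂ)) ζ := by
      refine ((hasDerivAt_inv hζ).hasFDerivAt.restrictScalars ℝ).congr_fderiv ?_
      ext; simp [mul_comm]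
    refine (h1.mul h2).congr_of_eventuallyEq ?_
    filter_upwards [isOpen_ne.mem_nhds hζ] with w hw using hslope w hw
  have hcont : Continuous (dslope g 0) := by
    rw [continuous_iff_continuousAt]
    intro ζ
    by_cases hζ : ζ = 0
    · subst hζ
      exact continuousAt_dslope_same.2 h0.self_of_nhds
    · exact (hderiv ζ hζ).continuousAt
  -- The divided difference `dslope` is continuous at 0, so 0 can be the exceptional point of the
  -- divergence theorem.
  have key := Complex.integral_boundary_rect_of_hasFDerivAt_real_off_countable (dslope g 0) f'
    ⟨-R, -R⟩ ⟨R, R⟩ {0} (countable_singleton 0) hcont.continuousOn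
    (fun ζ hζ => hderiv ζ hζ.2) (by
      simp only [hE]
      refine hcontE.continuousOn.integrableOn_compact ?_
      exact isCompact_uIcc.reProdIm isCompact_uIcc)
  simp only [hE] at key
  rw [← key]
  -- On the boundary g vanishes, so only -g(0)/ζ remains to be integrated.
  have hbd : ∀ ζ : ℂ, R ≤ ‖ζ‖ → dslope g 0 ζ = -g 0 * ζ⁻¹ := by
    intro ζ hζ
    rw [hslope ζ (norm_pos_iff.1 (hR.trans_le hζ)), hsupp ζ hζ, zero_sub]
  have hn1 : ∀ (x s : ℝ), |s| = R → R ≤ ‖(x : ℂ) + s * Complex.I‖ := by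
    intro x s hs
    refine hs.ge.trans ((le_of_eq ?_).trans (Complex.abs_im_le_norm _))
    simp
  have hn2 : ∀ (s y : ℝ), |s| = R → R ≤ ‖(s : ℂ) + y * Complex.I‖ := by
    intro s y hs
    refine hs.ge.trans ((le_of_eq ?_).trans (Complex.abs_re_le_norm _))
    simp
  have hR1 : |R| = R := abs_of_pos hR
  have hR2 : |(-R)| = R := by rw [abs_neg, hR1]
  simp only [hbd _ (hn1 _ _ hR1), hbd _ (hn1 _ _ hR2), hbd _ (hn2 _ _ hR1), hbd _ (hn2 _ _ hR2),
    intervalIntegral.integral_const_mul]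
  have := integral_boundary_square_inv hR
  simp only [smul_eq_mul] at this ⊢
  linear_combination (-g 0) * this

/-- The Cauchy–Pompeiu formula for compactly supported functions, at a point near which the function
is holomorphic. -/
theorem cauchy_pompeiu {g : ℂ → ℂ} (hg : ContDiff ℝ 1 g) (hs : HasCompactSupport g) {z : ℂ}
    (hz : ∀ᶠ w in 𝓝 z, DifferentiableAt ℂ g w) :
    ∫ x : ℝ, ∫ y : ℝ, dbar g (x + y * Complex.I) / ((x : ℂ) + y * Complex.I - z) =
      -(2 * Real.pi * Complex.I) * g z := by
  set G : ℂ → ℂ := fun ζ => g (z + ζ) with hG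
  have hGc : ContDiff ℝ 1 G := hg.comp (contDiff_const.add contDiff_id)
  have hdbar : ∀ ζ, dbar G ζ = dbar g (z + ζ) := by
    intro ζ
    simp only [dbar, hG, fderiv_comp_add_left]
  have hGs : HasCompactSupport G := hs.comp_homeomorph (Homeomorph.addLeft z)
  obtain ⟨R, hR, hRs⟩ : ∃ R > 0, tsupport G ⊆ Metric.ball 0 R := by
    obtain ⟨R, hR⟩ := hGs.isBounded.subset_ball (0 : ℂ)
    exact ⟨max R 1, by positivity, hR.trans (Metric.ball_subset_ball (le_max_left _ _))⟩
  have hnorm : ∀ ζ, R ≤ ‖ζ‖ → ζ ∉ tsupport G := by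
    intro ζ h1 h2
    have := hRs h2
    rw [mem_ball_zero_iff] at this
    linarith
  have hG0 : ∀ᶠ w in 𝓝 (0 : ℂ), DifferentiableAt ℂ G w := by
    have h1 : Tendsto (fun w : ℂ => z + w) (𝓝 0) (𝓝 z) := by
      have : Continuous fun w : ℂ => z + w := by fun_prop
      simpa using this.tendsto 0
    filter_upwards [h1.eventually hz] with w hw
    exact hw.comp w (by fun_prop)
  have key := cauchy_pompeiu_square hGc hR
    (fun ζ h => image_eq_zero_of_notMem_tsupport (hnorm ζ h)) hG0
  have hE0 : ∀ ζ, R ≤ ‖ζ‖ → dbar G ζ = 0 := fun ζ h =>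
    image_eq_zero_of_notMem_tsupport fun h2 => hnorm ζ h (tsupport_dbar_subset G h2)
  have hIoc : ∀ {s : ℝ}, |s| < R → s ∈ Ioc (-R) R := fun h =>
    ⟨(abs_lt.1 h).1, (abs_lt.1 h).2.le⟩
  have hinner : ∀ x : ℝ, ∫ y in (-R)..R, dbar G (x + y * Complex.I) / ((x : ℂ) + y * Complex.I) =
      ∫ y : ℝ, dbar G (x + y * Complex.I) / ((x : ℂ) + y * Complex.I) := by
    intro x
    refine intervalIntegral.integral_eq_integral_of_support_subset fun y hy => hIoc ?_
    by_contra h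
    refine hy ?_
    simp only
    rw [hE0, zero_div]
    refine (not_lt.1 h).trans ((le_of_eq ?_).trans (Complex.abs_im_le_norm _))
    simp
  simp only [hinner] at key
  rw [intervalIntegral.integral_eq_integral_of_support_subset] at key
  · have hshift : ∀ x : ℝ,
        ∫ y : ℝ, dbar G (x + y * Complex.I) / ((x : ℂ) + y * Complex.I) =
        ∫ y : ℝ, dbar g (((z.re + x : ℝ) : ℂ) + y * Complex.I) /
          (((z.re + x : ℝ) : ℂ) + y * Complex.I - z) := by
      intro x
      rw [← MeasureTheory.integral_add_left_eq_self (fun y : ℝ =>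
        dbar g (((z.re + x : ℝ) : ℂ) + y * Complex.I) /
          (((z.re + x : ℝ) : ℂ) + y * Complex.I - z)) z.im]
      refine MeasureTheory.integral_congr_ae (Eventually.of_forall fun y => ?_)
      have h1 : z + (x + y * Complex.I) =
          ((z.re + x : ℝ) : ℂ) + ((z.im + y : ℝ) : ℂ) * Complex.I := by
        apply Complex.ext <;> simp
      simp only [hdbar, ← h1, add_sub_cancel_left]
    simp only [hshift] at key
    rw [MeasureTheory.integral_add_left_eq_self (fun x : ℝ =>
      ∫ y : ℝ, dbar g ((x : ℂ) + y * Complex.I) / ((x : ℂ) + y * Complex.I - z)) z.re] at key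
    rw [key]
    simp [hG]
  · intro x hx
    refine hIoc ?_
    by_contra h
    refine hx ?_
    have : ∀ y : ℝ, dbar G (x + y * Complex.I) / ((x : ℂ) + y * Complex.I) = 0 := by
      intro y
      rw [hE0, zero_div]
      refine (not_lt.1 h).trans ((le_of_eq ?_).trans (Complex.abs_re_le_norm _))
      simp
    simp [this]

/-! ### Pushing poles: polynomial approximation of Cauchy kernels -/

/-- `g` is a uniform limit of polynomials on `T`. -/
def PolyApprox (T : Set ℂ) (g : ℂ → ℂ) : Prop :=
  ∀ ε > 0, ∃ P : ℂ[X], ∀ z ∈ T, ‖P.eval z - g z‖ < ε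

theorem PolyApprox.mono {S T : Set ℂ} {g : ℂ → ℂ} (h : PolyApprox T g) (hST : S ⊆ T) :
    PolyApprox S g := fun ε hε =>
  let ⟨P, hP⟩ := h ε hε
  ⟨P, fun z hz => hP z (hST hz)⟩

/-- Membership in a closed subalgebra makes approximability stable under products, geometric series
and integrals. -/
theorem polyApprox_iff {T : Set ℂ} [CompactSpace T] (g : C(T, ℂ)) (φ : ℂ → ℂ)
    (h : ∀ z : T, φ z = g z) :
    PolyApprox T φ ↔ g ∈ (polynomialFunctions T).topologicalClosure := by
  rw [← SetLike.mem_coe, Subalgebra.topologicalClosure_coe, Metric.mem_closure_iff,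
    polynomialFunctions_coe]
  refine forall₂_congr fun ε hε => ?_
  simp only [exists_range_iff]
  refine exists_congr fun P => ?_
  rw [ContinuousMap.dist_lt_iff hε]
  simp only [dist_eq_norm]
  refine ⟨fun H z => ?_, fun H z hz => ?_⟩
  · rw [norm_sub_rev, ← h]; exact H z z.2
  · have := H ⟨z, hz⟩
    rwa [norm_sub_rev, ← h] at this

theorem exists_mul_one_sub_eq_one {A : Type*} [NormedRing A] [CompleteSpace A] [NormedAlgebra ℂ A]
    (S : Subalgebra ℂ A) (hS : IsClosed (S : Set A)) {t : A} (ht : t ∈ S) (ht1 : ‖t‖ < 1) :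
    ∃ s ∈ S, s * (1 - t) = 1 := by
  refine ⟨∑' n : ℕ, t ^ n, ?_, geom_series_mul_neg t ht1⟩
  exact hS.mem_of_tendsto (summable_geometric_of_norm_lt_one ht1).hasSum
    (Eventually.of_forall fun s => sum_mem fun n _ => pow_mem ht n)

/-- Expand (a - z)⁻¹ = a⁻¹ ∑ (z/a)^n; by compactness the pointwise strict bound gives a norm below
1. -/
theorem polyApprox_inv_sub_of_norm_lt {T : Set ℂ} (hT : IsCompact T) {a : ℂ}
    (h : ∀ z ∈ T, ‖z‖ < ‖a‖) : PolyApprox T fun z => (a - z)⁻¹ := by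
  have := isCompact_iff_compactSpace.1 hT
  -- A point of T is needed here: if T is empty, a may be 0.
  have hne : ∀ z : T, a ≠ 0 := fun z => norm_pos_iff.1 ((norm_nonneg _).trans_lt (h z z.2))
  let S := (polynomialFunctions T).topologicalClosure
  let x : C(T, ℂ) := ⟨fun z => (z : ℂ), by fun_prop⟩
  have hx : x ∈ S := (polyApprox_iff x id fun _ => rfl).1 fun ε hε => ⟨X, fun z _ => by simpa⟩
  have ht1 : ‖a⁻¹ • x‖ < 1 := by
    rw [ContinuousMap.norm_lt_iff _ one_pos]
    intro z
    have h1 : ‖a‖ ≠ 0 := norm_ne_zero_iff.2 (hne z)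
    have h2 : ‖(a⁻¹ • x) z‖ = ‖(z : ℂ)‖ / ‖a‖ := by
      simp [x, norm_inv, div_eq_inv_mul]
    rw [h2, div_lt_one (norm_pos_iff.2 (hne z))]
    exact h z z.2
  obtain ⟨s, hs, hs1⟩ := exists_mul_one_sub_eq_one S
    (Subalgebra.isClosed_topologicalClosure _) (S.smul_mem hx a⁻¹) ht1
  refine (polyApprox_iff (a⁻¹ • s) _ fun z => ?_).2 (S.smul_mem hs a⁻¹)
  have h3 : s z * (1 - a⁻¹ * z) = 1 := by
    have := DFunLike.congr_fun hs1 z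
    simpa [x] using this
  have ha := hne z
  refine inv_eq_of_mul_eq_one_right ?_
  rw [ContinuousMap.smul_apply, smul_eq_mul]
  rw [← h3]
  field_simp

/-- Moving a pole from a to b: b - z = (a - z)(1 - (a - b)/(a - z)), and the second factor is
inverted by a geometric series in the kernel at a. -/
theorem PolyApprox.inv_sub_of_norm_lt {T : Set ℂ} (hT : IsCompact T) {a b : ℂ} (ha : a ∉ T)
    (hPA : PolyApprox T fun z => (a - z)⁻¹) (h : ∀ z ∈ T, ‖a - b‖ < ‖a - z‖) :
    PolyApprox T fun z => (b - z)⁻¹ := by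
  have := isCompact_iff_compactSpace.1 hT
  have hne : ∀ z : T, a - z ≠ 0 := fun z hz => ha (sub_eq_zero.1 hz ▸ z.2)
  let S := (polynomialFunctions T).topologicalClosure
  let k : C(T, ℂ) := ⟨fun z => (a - z)⁻¹, Continuous.inv₀ (by fun_prop) hne⟩
  have hk : k ∈ S := (polyApprox_iff k _ fun _ => rfl).1 hPA
  have ht1 : ‖(a - b) • k‖ < 1 := by
    rw [ContinuousMap.norm_lt_iff _ one_pos]
    intro z
    have h2 : ‖((a - b) • k) z‖ = ‖a - b‖ / ‖a - z‖ := by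
      simp [k, norm_inv, div_eq_mul_inv]
    rw [h2, div_lt_one (norm_pos_iff.2 (hne z))]
    exact h z z.2
  obtain ⟨s, hs, hs1⟩ := exists_mul_one_sub_eq_one S
    (Subalgebra.isClosed_topologicalClosure _) (S.smul_mem hk (a - b)) ht1
  refine (polyApprox_iff (k * s) _ fun z => ?_).2 (S.mul_mem hk hs)
  have h3 : s z * (1 - (a - b) * (a - z)⁻¹) = 1 := by
    have := DFunLike.congr_fun hs1 z
    simpa [k] using this
  have hz := hne z
  refine inv_eq_of_mul_eq_one_right ?_
  have h4 : (k * s) z = (a - z)⁻¹ * s z := rfl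
  rw [h4, ← h3]
  field_simp
  ring

/-- The Cauchy kernels with poles in `s` are uniform limits of polynomials on a common
neighbourhood of `K`. -/
def GoodPoles (K s : Set ℂ) : Prop :=
  ∃ δ > 0, ∀ b ∈ s, b ∉ Metric.cthickening δ K ∧
    PolyApprox (Metric.cthickening δ K) fun z => (b - z)⁻¹

theorem GoodPoles.union {K s t : Set ℂ} (hs : GoodPoles K s) (ht : GoodPoles K t) :
    GoodPoles K (s ∪ t) := by
  obtain ⟨δ₁, h₁, H₁⟩ := hs
  obtain ⟨δ₂, h₂, H₂⟩ := ht
  have m₁ : Metric.cthickening (min δ₁ δ₂) K ⊆ Metric.cthickening δ₁ K :=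
    Metric.cthickening_mono (min_le_left _ _) K
  have m₂ : Metric.cthickening (min δ₁ δ₂) K ⊆ Metric.cthickening δ₂ K :=
    Metric.cthickening_mono (min_le_right _ _) K
  refine ⟨min δ₁ δ₂, lt_min h₁ h₂, ?_⟩
  rintro b (hb | hb)
  · exact ⟨fun h => (H₁ b hb).1 (m₁ h), (H₁ b hb).2.mono m₁⟩
  · exact ⟨fun h => (H₂ b hb).1 (m₂ h), (H₂ b hb).2.mono m₂⟩

theorem goodPoles_of_norm_gt {K : Set ℂ} (hK : IsCompact K) {R : ℝ}
    (hKR : K ⊆ Metric.closedBall 0 R) {a : ℂ} (ha : R < ‖a‖) : GoodPoles K {a} := by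
  have hT : ∀ z ∈ Metric.cthickening ((‖a‖ - R) / 2) K, ‖z‖ < ‖a‖ := by
    intro z hz
    rw [hK.cthickening_eq_biUnion_closedBall (by linarith)] at hz
    simp only [mem_iUnion, exists_prop] at hz
    obtain ⟨x, hx, hzx⟩ := hz
    have h1 : ‖x‖ ≤ R := by simpa using hKR hx
    have h2 : ‖z - x‖ ≤ (‖a‖ - R) / 2 := by simpa [dist_eq_norm] using hzx
    have h3 := norm_le_norm_add_norm_sub' z x
    linarith
  refine ⟨(‖a‖ - R) / 2, by linarith, ?_⟩
  rintro b rfl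
  exact ⟨fun h => lt_irrefl _ (hT _ h), polyApprox_inv_sub_of_norm_lt hK.cthickening hT⟩

/-- With r the distance from a to K, points of the r/4-neighbourhood of K are at least 3r/4 from a,
so poles within r/2 of a are reached by one expansion, on one common neighbourhood. -/
theorem GoodPoles.ball {K : Set ℂ} (hK : IsCompact K) {a : ℂ} (ha : a ∉ K) (hKn : K.Nonempty)
    (h : GoodPoles K {a}) : GoodPoles K (Metric.ball a (Metric.infDist a K / 2)) := by
  obtain ⟨δ, hδ, H⟩ := h
  obtain ⟨haδ, hPA⟩ := H a rfl
  set r := Metric.infDist a K with hr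
  have hr0 : 0 < r := (hK.isClosed.notMem_iff_infDist_pos hKn).1 ha
  have m : Metric.cthickening (min δ (r / 4)) K ⊆ Metric.cthickening δ K :=
    Metric.cthickening_mono (min_le_left _ _) K
  have hdist : ∀ z ∈ Metric.cthickening (min δ (r / 4)) K, r / 2 < dist a z := by
    intro z hz
    rw [hK.cthickening_eq_biUnion_closedBall (by positivity)] at hz
    simp only [mem_iUnion, exists_prop] at hz
    obtain ⟨x, hx, hzx⟩ := hz
    have h1 : r ≤ dist a x := Metric.infDist_le_dist_of_mem hx
    have h2 : dist z x ≤ r / 4 := (Metric.mem_closedBall.1 hzx).trans (min_le_right _ _)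
    have h3 := dist_triangle a z x
    linarith
  refine ⟨min δ (r / 4), by positivity, fun b hb => ?_⟩
  rw [Metric.mem_ball, dist_comm] at hb
  refine ⟨fun hbT => ?_, (hPA.mono m).inv_sub_of_norm_lt hK.cthickening (fun h => haδ (m h)) ?_⟩
  · have := hdist b hbT
    linarith
  · intro z hz
    rw [← dist_eq_norm, ← dist_eq_norm]
    exact hb.trans (hdist z hz)

/-- The good poles off K form a set that is open and relatively closed, and contains every point
outside the disc. Together with ∞ it therefore covers the connected complement of C in the sphere.
-/
theorem goodPoles_of_isConnected {C : Set ℂ} (hC : IsClosed C)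
    (hconn : IsConnected ((((↑) : ℂ → OnePoint ℂ) '' C)ᶜ)) {R : ℝ}
    (hne : (C ∩ Metric.closedBall 0 R).Nonempty) {a : ℂ} (ha : a ∉ C ∩ Metric.closedBall 0 R) :
    GoodPoles (C ∩ Metric.closedBall 0 R) {a} := by
  set K := C ∩ Metric.closedBall (0 : ℂ) R with hKdef
  have hK : IsCompact K := (isCompact_closedBall (0 : ℂ) R).inter_left hC
  have hsing : ∀ {s : Set ℂ} {b : ℂ}, b ∈ s → GoodPoles K s → GoodPoles K {b} := by
    rintro s b hb ⟨δ, hδ, H⟩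
    exact ⟨δ, hδ, fun c hc => by rw [mem_singleton_iff.1 hc]; exact H b hb⟩
  set G : Set ℂ := {b | GoodPoles K {b}} with hG
  have hGK : G ⊆ Kᶜ := by
    rintro b ⟨δ, hδ, H⟩ hb
    exact (H b rfl).1 (Metric.self_subset_cthickening K hb)
  have hfar : ∀ b : ℂ, R < ‖b‖ → b ∈ G := fun b hb =>
    goodPoles_of_norm_gt hK inter_subset_right hb
  have hpos : ∀ b ∉ K, 0 < Metric.infDist b K := fun b hb =>
    (hK.isClosed.notMem_iff_infDist_pos hne).1 hb
  have hGo : IsOpen G := by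
    rw [Metric.isOpen_iff]
    intro b hb
    exact ⟨_, half_pos (hpos b (hGK hb)), fun c hc => hsing hc (hb.ball hK (hGK hb) hne)⟩
  have hVo : IsOpen (Kᶜ \ G) := by
    rw [Metric.isOpen_iff]
    rintro b ⟨hbK, hbG⟩
    have hr := hpos b hbK
    -- If c is within r/3 of b, where r is the distance from b to K, then c is at least 2r/3 from K;
    -- a good c would thus make b good as well.
    refine ⟨Metric.infDist b K / 3, by positivity, fun c hc => ?_⟩
    rw [Metric.mem_ball] at hc
    have h1 := Metric.infDist_le_infDist_add_dist (s := K) (x := b) (y := c)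
    rw [dist_comm] at h1
    have hcK : c ∉ K := by
      rw [hK.isClosed.notMem_iff_infDist_pos hne]
      linarith
    refine ⟨hcK, fun hcG => hbG (hsing ?_ (hcG.ball hK hcK hne))⟩
    rw [Metric.mem_ball, dist_comm]
    linarith
  -- A point of C missing from K lies outside the disc, so connectedness is needed only off C.
  by_cases haC : a ∈ C
  · refine hfar a (not_le.1 fun h => ha ⟨haC, ?_⟩)
    simpa using h
  by_contra haG
  have hGc : IsCompact Gᶜ := by
    refine (isCompact_closedBall (0 : ℂ) R).of_isClosed_subset hGo.isClosed_compl fun b hb => ?_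
    by_contra h
    exact hb (hfar b (by simpa using h))
  have hu : IsOpen (((↑) : ℂ → OnePoint ℂ) '' Gᶜ)ᶜ :=
    OnePoint.isOpen_compl_image_coe.2 ⟨hGo.isClosed_compl, hGc⟩
  have hv : IsOpen (((↑) : ℂ → OnePoint ℂ) '' (Kᶜ \ G)) := OnePoint.isOpen_image_coe.2 hVo
  obtain ⟨w, -, hw1, ⟨b, hb, rfl⟩⟩ := hconn.isPreconnected _ _ hu hv (by
      intro w hw
      by_cases hwu : w ∈ (((↑) : ℂ → OnePoint ℂ) '' Gᶜ)ᶜ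
      · exact Or.inl hwu
      · rw [notMem_compl_iff] at hwu
        obtain ⟨b, hb, rfl⟩ := hwu
        exact Or.inr ⟨b, ⟨fun hbK => hw ⟨b, hbK.1, rfl⟩, hb⟩, rfl⟩)
    ⟨OnePoint.infty, by simp, by simp⟩ ⟨a, by simpa using haC, ⟨a, ⟨fun h => haC h.1, haG⟩, rfl⟩⟩
  exact hw1 ⟨b, hb.2, rfl⟩

theorem goodPoles_of_isCompact {K : Set ℂ} (hK : IsCompact K) (hne : K.Nonempty)
    (h : ∀ a ∉ K, GoodPoles K {a}) {L : Set ℂ} (hL : IsCompact L) (hLK : L ⊆ Kᶜ) :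
    GoodPoles K L := by
  refine hL.induction_on ⟨1, one_pos, by simp⟩ ?_ (fun s t hs ht => hs.union ht) ?_
  · rintro s t hst ⟨δ, hδ, H⟩
    exact ⟨δ, hδ, fun b hb => H b (hst hb)⟩
  · intro a ha
    exact ⟨_, mem_nhdsWithin_of_mem_nhds (Metric.ball_mem_nhds a
      (half_pos ((hK.isClosed.notMem_iff_infDist_pos hne).1 (hLK ha)))),
      (h a (hLK ha)).ball hK (hLK ha) hne⟩

/-! ### Runge's theorem -/

open scoped Manifold in
/-- A holomorphic function near a compact set can be cut off to a compactly supported `C^1`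
function, without changing it near that compact set. -/
theorem exists_contDiff_cutoff {K U : Set ℂ} (hK : IsCompact K) (hU : IsOpen U) (hKU : K ⊆ U)
    {f : ℂ → ℂ} (hf : DifferentiableOn ℂ f U) :
    ∃ (g : ℂ → ℂ) (V : Set ℂ), ContDiff ℝ 1 g ∧ HasCompactSupport g ∧ IsOpen V ∧ K ⊆ V ∧ V ⊆ U ∧
      EqOn g f V := by
  obtain ⟨T, hT, hKT, hTU⟩ := exists_compact_between hK hU hKU
  obtain ⟨χ, h1, h0, -⟩ := exists_contMDiffMap_one_nhds_of_subset_interior (n := 1) 𝓘(ℝ, ℂ)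
    hK.isClosed hKT
  have hχ : ContDiff ℝ 1 χ := χ.contMDiff.contDiff
  obtain ⟨V, hV, hKV, hV1⟩ := eventually_nhdsSet_iff_exists.1 h1
  refine ⟨fun ζ => χ ζ • f ζ, V ∩ U, ?_, ?_, hV.inter hU, subset_inter hKV hKU,
    inter_subset_right, fun ζ hζ => by simp [hV1 ζ hζ.1]⟩
  · rw [contDiff_iff_contDiffAt]
    intro ζ
    by_cases hζ : ζ ∈ T
    · have h2 : ContDiffAt ℂ 1 f ζ := (hf.analyticAt (hU.mem_nhds (hTU hζ))).contDiffAt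
      exact hχ.contDiffAt.smul (h2.restrict_scalars ℝ)
    · refine (contDiffAt_const (c := (0 : ℂ))).congr_of_eventuallyEq ?_
      filter_upwards [hT.isClosed.isOpen_compl.mem_nhds hζ] with w hw
      rw [h0 w hw, zero_smul]
  · refine HasCompactSupport.intro hT fun ζ hζ => ?_
    rw [h0 ζ hζ, zero_smul]

/-- S is itself a Banach space: the integral is taken inside S and transported by the inclusion. -/
theorem integral_mem_of_isClosed {E : Type*} [NormedAddCommGroup E] [NormedSpace ℂ E]
    [CompleteSpace E] (S : Submodule ℂ E) (hS : IsClosed (S : Set E)) {F : ℝ × ℝ → E}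
    (hF : Continuous F) (hFs : HasCompactSupport F) (hFS : ∀ p, F p ∈ S) :
    ∫ p, F p ∈ S := by
  have : CompleteSpace S := hS.completeSpace_coe
  let F' : ℝ × ℝ → S := fun p => ⟨F p, hFS p⟩
  have hF' : Continuous F' := hF.subtype_mk _
  have hFs' : HasCompactSupport F' :=
    HasCompactSupport.intro hFs fun p hp => Subtype.ext (image_eq_zero_of_notMem_tsupport (f := F) hp)
  have h := S.subtypeL.integral_comp_comm (hF'.integrable_of_hasCompactSupport hFs')
    (μ := MeasureTheory.volume)
  have h2 : (∫ p, F p) = S.subtypeL (∫ p, F' p) := h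
  rw [h2]
  exact (∫ p, F' p).2

/-- The integrand of the Cauchy–Pompeiu formula as a family of continuous functions. -/
theorem exists_cauchy_pompeiu_integrand {g : ℂ → ℂ} (hg : ContDiff ℝ 1 g)
    (hs : HasCompactSupport g) {T V : Set ℂ} (hV : IsOpen V) (hTV : T ⊆ V)
    (hE : ∀ z ∈ V, dbar g z = 0) :
    ∃ F : ℝ × ℝ → C(T, ℂ), Continuous F ∧ HasCompactSupport F ∧ ∀ p t,
      F p t = dbar g (p.1 + p.2 * Complex.I) / ((p.1 : ℂ) + p.2 * Complex.I - t) := by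
  have hjoint : Continuous fun q : (ℝ × ℝ) × T =>
      dbar g (q.1.1 + q.1.2 * Complex.I) / ((q.1.1 : ℂ) + q.1.2 * Complex.I - q.2) := by
    rw [continuous_iff_continuousAt]
    rintro q
    have hpc : Continuous fun q : (ℝ × ℝ) × T => (q.1.1 : ℂ) + q.1.2 * Complex.I := by fun_prop
    -- Over V the numerator vanishes identically; off V the denominator is nonzero because T ⊆ V.
    by_cases hq : (q.1.1 : ℂ) + q.1.2 * Complex.I ∈ V
    · refine (continuousAt_const (y := (0 : ℂ))).congr ?_
      filter_upwards [hpc.continuousAt.preimage_mem_nhds (hV.mem_nhds hq)] with q' hq'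
      rw [hE _ hq', zero_div]
    · refine ContinuousAt.div ((continuous_dbar hg).comp hpc).continuousAt
        (by fun_prop) fun h => hq ?_
      rw [sub_eq_zero.1 h]
      exact hTV q.2.2
  have hcomp : IsCompact (tsupport (dbar g)) :=
    hs.of_isClosed_subset (isClosed_tsupport _) (tsupport_dbar_subset g)
  let J : C((ℝ × ℝ) × T, ℂ) := ⟨_, hjoint⟩
  have hJ : ∀ p t, J.curry p t =
      dbar g (p.1 + p.2 * Complex.I) / ((p.1 : ℂ) + p.2 * Complex.I - t) := fun p t => rfl
  refine ⟨J.curry, J.curry.continuous, ?_, hJ⟩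
  refine HasCompactSupport.intro
    (hcomp.image (f := fun z : ℂ => (z.re, z.im)) (by fun_prop)) fun p hp => ?_
  have h1 : dbar g (p.1 + p.2 * Complex.I) = 0 := by
    refine image_eq_zero_of_notMem_tsupport fun h => hp ⟨_, h, ?_⟩
    simp
  ext t
  rw [hJ, h1, zero_div, ContinuousMap.zero_apply]

/-- A function whose Cauchy–Pompeiu representation has all its kernels approximable by polynomials
is itself a uniform limit of polynomials. -/
theorem polyApprox_of_dbar {g : ℂ → ℂ} (hg : ContDiff ℝ 1 g) (hs : HasCompactSupport g)
    {T V : Set ℂ} (hT : IsCompact T) (hV : IsOpen V) (hTV : T ⊆ V)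
    (hgV : DifferentiableOn ℂ g V)
    (hpoles : ∀ b ∈ tsupport (dbar g), PolyApprox T fun z => (b - z)⁻¹) : PolyApprox T g := by
  have := isCompact_iff_compactSpace.1 hT
  have hgV' : ∀ z ∈ V, DifferentiableAt ℂ g z := fun z hz => hgV.differentiableAt (hV.mem_nhds hz)
  have hE : ∀ z ∈ V, dbar g z = 0 := fun z hz => dbar_eq_zero (hgV' z hz)
  obtain ⟨F, hF, hFs, hFv⟩ := exists_cauchy_pompeiu_integrand hg hs hV hTV hE
  have hFS : ∀ p, F p ∈ (polynomialFunctions T).topologicalClosure := by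
    intro p
    by_cases h : (p.1 : ℂ) + p.2 * Complex.I ∈ tsupport (dbar g)
    · refine (polyApprox_iff (F p) (fun z => dbar g (p.1 + p.2 * Complex.I) *
        ((p.1 : ℂ) + p.2 * Complex.I - z)⁻¹) fun z => ?_).1 fun ε hε => ?_
      · rw [hFv, div_eq_mul_inv]
      · set c := dbar g (p.1 + p.2 * Complex.I)
        obtain ⟨P, hP⟩ := hpoles _ h (ε / (‖c‖ + 1)) (by positivity)
        refine ⟨C c * P, fun z hz => ?_⟩
        rw [eval_mul, eval_C, ← mul_sub, norm_mul]
        calc ‖c‖ * _ ≤ ‖c‖ * (ε / (‖c‖ + 1)) := by gcongr; exact (hP z hz).le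
          _ < (‖c‖ + 1) * (ε / (‖c‖ + 1)) := by gcongr; linarith
          _ = ε := by field_simp
    · have : F p = 0 := by
        ext t
        rw [hFv, image_eq_zero_of_notMem_tsupport h, zero_div, ContinuousMap.zero_apply]
      rw [this]
      exact zero_mem _
  have hint := integral_mem_of_isClosed
    (Subalgebra.toSubmodule (polynomialFunctions T).topologicalClosure)
    (Subalgebra.isClosed_topologicalClosure _) hF hFs hFS
  have hFi := hF.integrable_of_hasCompactSupport hFs (μ := MeasureTheory.volume)
  refine (polyApprox_iff ((-(2 * Real.pi * Complex.I))⁻¹ • ∫ p, F p) g fun z => ?_).2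
    (Submodule.smul_mem _ _ hint)
  have heval : (∫ p, F p) z = ∫ p, F p z :=
    ((ContinuousMap.evalCLM ℂ z).integral_comp_comm hFi).symm
  have hFz : MeasureTheory.Integrable (fun p => F p z) :=
    (ContinuousMap.evalCLM ℂ z).integrable_comp hFi
  have hval : ∫ p, F p z = -(2 * Real.pi * Complex.I) * g z := by
    rw [MeasureTheory.Measure.volume_eq_prod, MeasureTheory.integral_prod _ hFz]
    simp only [hFv]
    refine cauchy_pompeiu hg hs ?_
    filter_upwards [hV.mem_nhds (hTV z.2)] with w hw using hgV' w hw
  rw [ContinuousMap.smul_apply, heval, hval, smul_eq_mul, inv_mul_cancel_left₀]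
  simp [Real.pi_ne_zero]

/-- Runge's theorem on a neighbourhood of `C ∩ {|z| ≤ R}`, where the complement of `C` in the
Riemann sphere is connected. -/
theorem exists_polyApprox_cthickening {C : Set ℂ} (hC : IsClosed C)
    (hconn : IsConnected ((((↑) : ℂ → OnePoint ℂ) '' C)ᶜ)) {R : ℝ}
    (hne : (C ∩ Metric.closedBall 0 R).Nonempty) {U : Set ℂ} (hU : IsOpen U)
    (hCU : C ∩ Metric.closedBall 0 R ⊆ U) {f : ℂ → ℂ} (hf : DifferentiableOn ℂ f U) :
    ∃ δ > 0, Metric.cthickening δ (C ∩ Metric.closedBall 0 R) ⊆ U ∧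
      PolyApprox (Metric.cthickening δ (C ∩ Metric.closedBall 0 R)) f := by
  set K := C ∩ Metric.closedBall (0 : ℂ) R with hKdef
  have hK : IsCompact K := (isCompact_closedBall (0 : ℂ) R).inter_left hC
  obtain ⟨g, V, hg, hgs, hV, hKV, hVU, hgf⟩ := exists_contDiff_cutoff hK hU hCU hf
  have hgV : DifferentiableOn ℂ g V := (hf.mono hVU).congr hgf
  have hcomp : IsCompact (tsupport (dbar g)) :=
    hgs.of_isClosed_subset (isClosed_tsupport _) (tsupport_dbar_subset g)
  -- All poles in the representation of g lie in a compact set disjoint from K, so a single δ₁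
  -- serves them all.
  have hsub : tsupport (dbar g) ⊆ Vᶜ := closure_minimal
    (fun z hz hzV => hz (dbar_eq_zero (hgV.differentiableAt (hV.mem_nhds hzV)))) hV.isClosed_compl
  obtain ⟨δ₁, hδ₁, H⟩ := goodPoles_of_isCompact hK hne
    (fun a ha => goodPoles_of_isConnected hC hconn hne ha) hcomp
    (hsub.trans (compl_subset_compl.2 hKV))
  obtain ⟨δ₂, hδ₂, hδV⟩ := hK.exists_cthickening_subset_open hV hKV
  have hTV : Metric.cthickening (min δ₁ δ₂) K ⊆ V :=
    (Metric.cthickening_mono (min_le_right _ _) K).trans hδV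
  refine ⟨min δ₁ δ₂, lt_min hδ₁ hδ₂, hTV.trans hVU, fun ε hε => ?_⟩
  obtain ⟨P, hP⟩ := polyApprox_of_dbar hg hgs hK.cthickening hV hTV hgV
    (fun b hb => (H b hb).2.mono (Metric.cthickening_mono (min_le_left _ _) K)) ε hε
  exact ⟨P, fun z hz => by rw [← hgf (hTV hz)]; exact hP z hz⟩

/-- Runge's theorem, with simultaneous approximation of derivatives. -/
theorem exists_polynomial_iteratedDeriv_lt {C : Set ℂ} (hC : IsClosed C)
    (hconn : IsConnected ((((↑) : ℂ → OnePoint ℂ) '' C)ᶜ)) {R : ℝ}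
    (hne : (C ∩ Metric.closedBall 0 R).Nonempty) {U : Set ℂ} (hU : IsOpen U)
    (hCU : C ∩ Metric.closedBall 0 R ⊆ U) {f : ℂ → ℂ} (hf : DifferentiableOn ℂ f U) (L : ℕ)
    {ε : ℝ} (hε : 0 < ε) :
    ∃ P : ℂ[X], ∀ l ≤ L, ∀ z ∈ C ∩ Metric.closedBall 0 R,
      ‖iteratedDeriv l (fun w => P.eval w) z - iteratedDeriv l f z‖ < ε := by
  obtain ⟨δ, hδ, hδU, H⟩ := exists_polyApprox_cthickening hC hconn hne hU hCU hf
  -- The error η for values is small enough for Cauchy's estimates at radius δ, for all orders up to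
  -- L at once.
  obtain ⟨η, hη, hηε⟩ : ∃ η > 0, ∀ l ≤ L, (l.factorial : ℝ) * η / δ ^ l < ε := by
    have h1 : ∀ᶠ η : ℝ in 𝓝 0, ∀ l ∈ Finset.range (L + 1), (l.factorial : ℝ) * η / δ ^ l < ε := by
      rw [Filter.eventually_all_finset]
      intro l _
      have hc : Continuous fun η : ℝ => (l.factorial : ℝ) * η / δ ^ l := by fun_prop
      exact hc.continuousAt.eventually_lt continuousAt_const (by simpa using hε)
    obtain ⟨η, h2, h3⟩ := ((h1.filter_mono nhdsWithin_le_nhds).and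
      (self_mem_nhdsWithin : Ioi (0 : ℝ) ∈ 𝓝[>] 0)).exists
    exact ⟨η, h3, fun l hl => h2 l (by simpa [Nat.lt_succ_iff] using hl)⟩
  obtain ⟨P, hP⟩ := H η hη
  refine ⟨P, fun l hl z hz => (norm_iteratedDeriv_sub_le hU P.differentiable.differentiableOn hf hδ
    (C := η) ?_ ?_ l).trans_lt (hηε l hl)⟩
  · exact (Metric.closedBall_subset_cthickening hz δ).trans hδU
  · exact fun w hw => (hP w (Metric.closedBall_subset_cthickening hz δ hw)).le

/-! ### Padé approximants and Hankel determinants -/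

/-- The polynomial with coefficients `c 0, …, c (n - 1)`. -/
def polyOfCoeffs (n : ℕ) (c : ℕ → ℂ) : ℂ[X] := ∑ j ∈ Finset.range n, C (c j) * X ^ j

theorem coeff_polyOfCoeffs (n : ℕ) (c : ℕ → ℂ) (j : ℕ) :
    (polyOfCoeffs n c).coeff j = if j < n then c j else 0 := by
  simp [polyOfCoeffs, coeff_C_mul, coeff_X_pow]

theorem natDegree_polyOfCoeffs_le (n : ℕ) (c : ℕ → ℂ) : (polyOfCoeffs (n + 1) c).natDegree ≤ n := by
  rw [natDegree_le_iff_coeff_eq_zero]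
  intro j hj
  rw [coeff_polyOfCoeffs, if_neg (by omega)]

theorem eval_polyOfCoeffs (n : ℕ) (c : ℕ → ℂ) (z : ℂ) :
    (polyOfCoeffs n c).eval z = ∑ j ∈ Finset.range n, c j * z ^ j := by
  simp [polyOfCoeffs, eval_finsetSum]

/-- The Taylor series of `f` at `0`. -/
def taylorSeries (f : ℂ → ℂ) : PowerSeries ℂ := PowerSeries.mk (taylorCoeff f)

theorem coeff_mul_taylorSeries (f : ℂ → ℂ) (Q : ℂ[X]) {n : ℕ} (hQ : ∀ j, n ≤ j → Q.coeff j = 0)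
    (v : ℕ) : PowerSeries.coeff v ((Q : PowerSeries ℂ) * taylorSeries f) =
      ∑ j ∈ Finset.range n, Q.coeff j * taylorCoeffInt f ((v : ℤ) - j) := by
  rw [PowerSeries.coeff_mul, Finset.Nat.sum_antidiagonal_eq_sum_range_succ_mk]
  have h1 : ∀ j ∈ Finset.range (v + 1), PowerSeries.coeff j (Q : PowerSeries ℂ) *
      PowerSeries.coeff (v - j) (taylorSeries f) =
      Q.coeff j * taylorCoeffInt f ((v : ℤ) - j) := by
    intro j hj
    have hjv : j ≤ v := by simpa [Nat.lt_succ_iff] using hj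
    rw [taylorCoeffInt, if_neg (by omega), taylorSeries, PowerSeries.coeff_mk,
      Polynomial.coeff_coe, ← Nat.cast_sub hjv, Int.toNat_natCast]
  rw [Finset.sum_congr rfl h1]
  have e1 : ∑ j ∈ Finset.range (v + 1), Q.coeff j * taylorCoeffInt f ((v : ℤ) - j) =
      ∑ j ∈ Finset.range (v + 1 + n), Q.coeff j * taylorCoeffInt f ((v : ℤ) - j) := by
    refine Finset.sum_subset (Finset.range_mono (by omega)) fun j _ hj => ?_
    have : v < j := by simpa [Nat.lt_succ_iff] using hj
    rw [taylorCoeffInt, if_pos (by omega), mul_zero]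
  have e2 : ∑ j ∈ Finset.range n, Q.coeff j * taylorCoeffInt f ((v : ℤ) - j) =
      ∑ j ∈ Finset.range (v + 1 + n), Q.coeff j * taylorCoeffInt f ((v : ℤ) - j) := by
    refine Finset.sum_subset (Finset.range_mono (by omega)) fun j _ hj => ?_
    rw [hQ j (by simpa using hj), zero_mul]
  rw [e1, e2]

/-- D is a unit among power series, so both conditions say that X^(n+1) divides the same series up
to a unit. This makes the Padé conditions linear in N and D. -/
theorem coeff_mul_inv_eq_iff (f : ℂ → ℂ) (N : ℂ[X]) {D : ℂ[X]} (hD : D.coeff 0 = 1) (n : ℕ) :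
    (∀ v ≤ n, PowerSeries.coeff v ((N : PowerSeries ℂ) * (D : PowerSeries ℂ)⁻¹) =
      taylorCoeff f v) ↔
    ∀ v ≤ n, N.coeff v = PowerSeries.coeff v ((D : PowerSeries ℂ) * taylorSeries f) := by
  have hD' : (D : PowerSeries ℂ) * (D : PowerSeries ℂ)⁻¹ = 1 := by
    refine PowerSeries.mul_inv_cancel _ ?_
    rw [Polynomial.constantCoeff_coe, hD]
    exact one_ne_zero
  have h1 : (∀ v ≤ n, PowerSeries.coeff v ((N : PowerSeries ℂ) * (D : PowerSeries ℂ)⁻¹) =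
      taylorCoeff f v) ↔
      PowerSeries.X ^ (n + 1) ∣ (N : PowerSeries ℂ) * (D : PowerSeries ℂ)⁻¹ - taylorSeries f := by
    rw [PowerSeries.X_pow_dvd_iff]
    simp only [map_sub, sub_eq_zero, Nat.lt_succ_iff, taylorSeries, PowerSeries.coeff_mk]
  have h2 : (∀ v ≤ n, N.coeff v = PowerSeries.coeff v ((D : PowerSeries ℂ) * taylorSeries f)) ↔
      PowerSeries.X ^ (n + 1) ∣ (N : PowerSeries ℂ) - (D : PowerSeries ℂ) * taylorSeries f := by
    rw [PowerSeries.X_pow_dvd_iff]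
    simp only [map_sub, sub_eq_zero, Nat.lt_succ_iff, Polynomial.coeff_coe]
  rw [h1, h2]
  constructor
  · intro h
    have e : (N : PowerSeries ℂ) - (D : PowerSeries ℂ) * taylorSeries f =
        (D : PowerSeries ℂ) * ((N : PowerSeries ℂ) * (D : PowerSeries ℂ)⁻¹ - taylorSeries f) := by
      linear_combination (-(N : PowerSeries ℂ)) * hD'
    rw [e]
    exact Dvd.dvd.mul_left h _
  · intro h
    have e : (N : PowerSeries ℂ) * (D : PowerSeries ℂ)⁻¹ - taylorSeries f =
        (D : PowerSeries ℂ)⁻¹ * ((N : PowerSeries ℂ) - (D : PowerSeries ℂ) * taylorSeries f) := by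
      linear_combination (taylorSeries f) * hD'
    rw [e]
    exact Dvd.dvd.mul_left h _

/-- The matrix whose determinant defines `D_{p,q}`. -/
def hankel (f : ℂ → ℂ) (p q : ℕ) : Matrix (Fin q) (Fin q) ℂ :=
  Matrix.of fun i j => taylorCoeffInt f ((p : ℤ) - (q : ℤ) + 1 + (i : ℕ) + (j : ℕ))

/-- Hankel indices increase where convolution indices decrease, hence the reversal k ↦ q - 1 - k. -/
theorem hankel_mulVec (f : ℂ → ℂ) (p q : ℕ) (c : ℕ → ℂ) (i : Fin q) :
    (hankel f p q).mulVec (fun k => c (q - 1 - k)) i =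
      ∑ j ∈ Finset.range q, c j * taylorCoeffInt f ((p : ℤ) + i - j) := by
  rw [← Finset.sum_range_reflect, ← Fin.sum_univ_eq_sum_range
    (fun j => c (q - 1 - j) * taylorCoeffInt f ((p : ℤ) + i - ((q - 1 - j : ℕ) : ℤ)))]
  simp only [Matrix.mulVec, dotProduct]
  refine Finset.sum_congr rfl fun k _ => ?_
  rw [hankel, Matrix.of_apply, mul_comm]
  congr 2
  have := k.2
  omega

theorem coeff_den_mul (f : ℂ → ℂ) (p q : ℕ) {D : ℂ[X]} (hD : D.natDegree ≤ q) (i : Fin q) :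
    PowerSeries.coeff (p + 1 + i) ((D : PowerSeries ℂ) * taylorSeries f) =
      (hankel f p q).mulVec (fun k => D.coeff (q - 1 - k + 1)) i +
        D.coeff 0 * taylorCoeffInt f ((p : ℤ) + 1 + i) := by
  rw [hankel_mulVec f p q (fun j => D.coeff (j + 1)), coeff_mul_taylorSeries f D (n := q + 1)
    (fun j hj => coeff_eq_zero_of_natDegree_lt (by omega)), Finset.sum_range_succ']
  push_cast
  congr 1
  · refine Finset.sum_congr rfl fun j _ => ?_
    congr 2
    ring

/-- The solution of the linear system for the coefficients of the Padé denominator. -/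
def padeVec (f : ℂ → ℂ) (p q : ℕ) : Fin q → ℂ :=
  (hankel f p q)⁻¹.mulVec fun i => -taylorCoeffInt f ((p : ℤ) + 1 + (i : ℕ))

/-- The coefficients of the Padé denominator. -/
def denCoeff (f : ℂ → ℂ) (p q j : ℕ) : ℂ :=
  -- The index q - j undoes the reversal of the Hankel columns. Values at j > q are junk, cut off in
  -- `padeDen`.
  if j = 0 then 1 else if h : q - j < q then padeVec f p q ⟨q - j, h⟩ else 0

/-- The Padé denominator. -/
def padeDen (f : ℂ → ℂ) (p q : ℕ) : ℂ[X] := polyOfCoeffs (q + 1) (denCoeff f p q)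

/-- The coefficients of the Padé numerator. -/
def numCoeff (f : ℂ → ℂ) (p q v : ℕ) : ℂ :=
  ∑ j ∈ Finset.range (q + 1), denCoeff f p q j * taylorCoeffInt f ((v : ℤ) - j)

/-- The Padé numerator. -/
def padeNum (f : ℂ → ℂ) (p q : ℕ) : ℂ[X] := polyOfCoeffs (p + 1) (numCoeff f p q)

theorem coeff_padeDen {f : ℂ → ℂ} {p q j : ℕ} (hj : j ≤ q) :
    (padeDen f p q).coeff j = denCoeff f p q j := by
  rw [padeDen, coeff_polyOfCoeffs, if_pos (by omega)]

theorem numCoeff_eq (f : ℂ → ℂ) (p q v : ℕ) :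
    numCoeff f p q v =
      PowerSeries.coeff v ((padeDen f p q : PowerSeries ℂ) * taylorSeries f) := by
  rw [coeff_mul_taylorSeries f (padeDen f p q) (n := q + 1) fun j hj => coeff_eq_zero_of_natDegree_lt
    ((natDegree_polyOfCoeffs_le q _).trans_lt (by omega))]
  refine Finset.sum_congr rfl fun j hj => ?_
  rw [coeff_padeDen (by simpa [Nat.lt_succ_iff] using hj)]

theorem InD.isUnit_det_hankel {f : ℂ → ℂ} {p q : ℕ} (h : InD f p q) :
    IsUnit (hankel f p q).det :=
  isUnit_iff_ne_zero.2 h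

/-- The numerator is the truncation of D·f after degree p; the linear system kills the coefficients
of index p + 1, …, p + q. -/
theorem isPade_padeNum_padeDen {f : ℂ → ℂ} {p q : ℕ} (h : InD f p q) :
    IsPade f p q (padeNum f p q) (padeDen f p q) := by
  have h0 : (padeDen f p q).coeff 0 = 1 := by rw [coeff_padeDen (Nat.zero_le _), denCoeff, if_pos rfl]
  refine ⟨natDegree_polyOfCoeffs_le p _, natDegree_polyOfCoeffs_le q _, h0, ?_⟩
  rw [coeff_mul_inv_eq_iff f _ h0]
  intro v hv
  rw [← numCoeff_eq, padeNum, coeff_polyOfCoeffs]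
  split_ifs with hvp
  · rfl
  · obtain ⟨i, rfl⟩ := Nat.exists_eq_add_of_le (not_lt.1 hvp)
    have hi : i < q := by omega
    rw [numCoeff_eq]
    have h1 := coeff_den_mul f p q (natDegree_polyOfCoeffs_le q (denCoeff f p q)) ⟨i, hi⟩
    change PowerSeries.coeff (p + 1 + i) ((padeDen f p q : PowerSeries ℂ) * taylorSeries f) = _ at h1
    rw [h1]
    have h2 : (fun k : Fin q => (polyOfCoeffs (q + 1) (denCoeff f p q)).coeff (q - 1 - k + 1)) =
        padeVec f p q := by
      funext k
      have hk := k.2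
      rw [coeff_polyOfCoeffs, if_pos (by omega), denCoeff, if_neg (by omega), dif_pos (by omega)]
      congr 1
      ext
      simp only
      omega
    rw [h2, padeVec, Matrix.mulVec_mulVec, Matrix.mul_nonsing_inv _ h.isUnit_det_hankel,
      Matrix.one_mulVec]
    change 0 = _ + (padeDen f p q).coeff 0 * _
    rw [h0]
    simp

/-- The coefficients of index p + 1, …, p + q give an invertible system for D, and D then determines
N. Any approximant can thus be replaced by the explicit one. -/
theorem IsPade.eq_of_inD {f : ℂ → ℂ} {p q : ℕ} (h : InD f p q) {N D : ℂ[X]}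
    (hP : IsPade f p q N D) : N = padeNum f p q ∧ D = padeDen f p q := by
  have hco := (coeff_mul_inv_eq_iff f N hP.den_coeff_zero (p + q)).1 hP.coeff_eq
  have hvec : (fun k : Fin q => D.coeff (q - 1 - k + 1)) = padeVec f p q := by
    have h1 : (hankel f p q).mulVec (fun k => D.coeff (q - 1 - k + 1)) =
        fun i : Fin q => -taylorCoeffInt f ((p : ℤ) + 1 + (i : ℕ)) := by
      funext i
      have hi := i.2
      have h2 := coeff_den_mul f p q hP.natDegree_den_le i
      rw [← hco _ (by omega), coeff_eq_zero_of_natDegree_lt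
        (hP.natDegree_num_le.trans_lt (by omega)), hP.den_coeff_zero, one_mul] at h2
      exact eq_neg_of_add_eq_zero_left h2.symm
    rw [padeVec, ← h1, Matrix.mulVec_mulVec, Matrix.nonsing_inv_mul _ h.isUnit_det_hankel,
      Matrix.one_mulVec]
  have hD : D = padeDen f p q := by
    ext j
    rw [padeDen, coeff_polyOfCoeffs]
    split_ifs with hj
    · rw [denCoeff]
      split_ifs with h1 h2
      · rw [h1, hP.den_coeff_zero]
      · rw [← hvec]
        congr 1
        simp only
        omega
      · omega
    · exact coeff_eq_zero_of_natDegree_lt (hP.natDegree_den_le.trans_lt (by omega))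
  refine ⟨?_, hD⟩
  ext v
  rw [padeNum, coeff_polyOfCoeffs]
  split_ifs with hv
  · rw [numCoeff_eq, ← hD, hco v (by omega)]
  · exact coeff_eq_zero_of_natDegree_lt (hP.natDegree_num_le.trans_lt (by omega))

/-- Kronecker's criterion: a Padé approximant with coprime numerator and denominator, the latter of
full degree, forces the Hankel determinant to be nonzero. -/
theorem IsPade.inD_of_isCoprime {f : ℂ → ℂ} {p q : ℕ} {N D : ℂ[X]} (hP : IsPade f p q N D)
    (hq : D.natDegree = q) (hcop : IsCoprime D N) : InD f p q := by
  have hco := (coeff_mul_inv_eq_iff f N hP.den_coeff_zero (p + q)).1 hP.coeff_eq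
  intro hdet
  obtain ⟨x, hx0, hx⟩ := Matrix.exists_mulVec_eq_zero_iff.2 hdet
  change (hankel f p q).mulVec x = 0 at hx
  refine hx0 ?_
  -- A kernel vector, read backwards, is a polynomial Q of degree < q for which Q·f has zero
  -- coefficients at p, …, p + q - 1. M below is the part of Q·f of degree < p.
  set c : ℕ → ℂ := fun j => if h : q - 1 - j < q then x ⟨q - 1 - j, h⟩ else 0 with hc
  have hcx : (fun k : Fin q => c (q - 1 - k)) = x := by
    funext k
    have hk := k.2
    rw [hc]
    simp only
    rw [dif_pos (by omega)]
    congr 1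
    ext
    simp only
    omega
  set Q := polyOfCoeffs q c with hQ
  have hQc : ∀ j, q ≤ j → Q.coeff j = 0 := fun j hj => by
    rw [hQ, coeff_polyOfCoeffs, if_neg (by omega)]
  have hQS : ∀ i < q, PowerSeries.coeff (p + i) ((Q : PowerSeries ℂ) * taylorSeries f) = 0 := by
    intro i hi
    rw [coeff_mul_taylorSeries f Q hQc]
    have h1 := hankel_mulVec f p q c ⟨i, hi⟩
    rw [hcx, hx] at h1
    rw [Pi.zero_apply] at h1
    rw [h1]
    refine Finset.sum_congr rfl fun j hj => ?_
    rw [hQ, coeff_polyOfCoeffs, if_pos (by simpa using hj)]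
    push_cast
    rfl
  set M := polyOfCoeffs p fun v => PowerSeries.coeff v ((Q : PowerSeries ℂ) * taylorSeries f)
    with hM
  have hdvd : PowerSeries.X ^ (p + q) ∣ ((Q * N - D * M : ℂ[X]) : PowerSeries ℂ) := by
    have e : ((Q * N - D * M : ℂ[X]) : PowerSeries ℂ) =
        (Q : PowerSeries ℂ) * ((N : PowerSeries ℂ) - (D : PowerSeries ℂ) * taylorSeries f) +
        (D : PowerSeries ℂ) * ((Q : PowerSeries ℂ) * taylorSeries f - (M : PowerSeries ℂ)) := by
      push_cast
      ring
    rw [e]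
    refine dvd_add (Dvd.dvd.mul_left ?_ _) (Dvd.dvd.mul_left ?_ _)
    · rw [PowerSeries.X_pow_dvd_iff]
      intro v hv
      rw [map_sub, Polynomial.coeff_coe, hco v hv.le, sub_self]
    · rw [PowerSeries.X_pow_dvd_iff]
      intro v hv
      rw [map_sub, Polynomial.coeff_coe, hM, coeff_polyOfCoeffs]
      split_ifs with h
      · rw [sub_self]
      · obtain ⟨i, rfl⟩ := Nat.exists_eq_add_of_le (not_lt.1 h)
        rw [hQS i (by omega), sub_zero]
  -- Both products have degree < p + q, while their difference is divisible by X^(p+q). Then D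
  -- divides QN, hence Q, which has smaller degree.
  have hzero : Q * N - D * M = 0 := by
    ext v
    rw [coeff_zero]
    by_cases hv : v < p + q
    · have := PowerSeries.X_pow_dvd_iff.1 hdvd v hv
      rwa [Polynomial.coeff_coe] at this
    · rw [coeff_sub, coeff_mul, coeff_mul, Finset.sum_eq_zero, Finset.sum_eq_zero, sub_zero]
      · rintro ⟨i, j⟩ hij
        rw [Finset.HasAntidiagonal.mem_antidiagonal] at hij
        simp only at hij ⊢
        by_cases hi : i ≤ q
        · rw [hM, coeff_polyOfCoeffs, if_neg (by omega), mul_zero]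
        · rw [coeff_eq_zero_of_natDegree_lt (hP.natDegree_den_le.trans_lt (not_le.1 hi)), zero_mul]
      · rintro ⟨i, j⟩ hij
        rw [Finset.HasAntidiagonal.mem_antidiagonal] at hij
        simp only at hij ⊢
        by_cases hi : i < q
        · rw [coeff_eq_zero_of_natDegree_lt (hP.natDegree_num_le.trans_lt (by omega)), mul_zero]
        · rw [hQc i (not_lt.1 hi), zero_mul]
  have hDQ : D ∣ Q := hcop.dvd_of_dvd_mul_right ⟨M, sub_eq_zero.1 hzero⟩
  rw [← hcx]
  funext k
  have hk := k.2
  have hQ0 : Q = 0 := by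
    refine eq_zero_of_dvd_of_natDegree_lt hDQ ?_
    rw [hq]
    obtain ⟨r, rfl⟩ : ∃ r, q = r + 1 := ⟨q - 1, by omega⟩
    exact Nat.lt_succ_of_le (natDegree_polyOfCoeffs_le r c)
  have h2 : Q.coeff (q - 1 - k) = c (q - 1 - k) := by
    rw [hQ, coeff_polyOfCoeffs, if_pos (by omega)]
  rw [← h2, hQ0, coeff_zero, Pi.zero_apply]

/-- A polynomial whose Padé approximant of type `[p/q]` is `P / (1 - εX)^q`. -/
def geomPoly (P : ℂ[X]) (p q : ℕ) (ε : ℂ) : ℂ[X] :=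
  P * (∑ k ∈ Finset.range (p + q + 1), (C ε * X) ^ k) ^ q

/-- Telescoping gives (1 - εX)^q · `geomPoly P p q ε` = P · (1 - (εX)^(p+q+1))^q, which is P modulo
X^(p+q+1). -/
theorem isPade_geomPoly {f : ℂ → ℂ} {P : ℂ[X]} {p q : ℕ} {ε : ℂ} (hP : P.natDegree ≤ p)
    (hf : ∀ v, taylorCoeff f v = (geomPoly P p q ε).coeff v) :
    IsPade f p q P ((1 - C ε * X) ^ q) := by
  have h0 : ((1 - C ε * X) ^ q : ℂ[X]).coeff 0 = 1 := by
    simp [coeff_zero_eq_eval_zero]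
  refine ⟨hP, ?_, h0, ?_⟩
  · refine natDegree_pow_le.trans ?_
    have : (1 - C ε * X : ℂ[X]).natDegree ≤ 1 := by compute_degree
    nlinarith
  · rw [coeff_mul_inv_eq_iff f _ h0]
    have hser : taylorSeries f = (geomPoly P p q ε : PowerSeries ℂ) := by
      ext v
      rw [taylorSeries, PowerSeries.coeff_mk, hf, Polynomial.coeff_coe]
    have hprod : (1 - C ε * X) ^ q * geomPoly P p q ε = P * (1 - (C ε * X) ^ (p + q + 1)) ^ q := by
      rw [geomPoly, ← mul_neg_geom_sum (C ε * X) (p + q + 1), mul_pow]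
      ring
    obtain ⟨W, hW⟩ : (X : ℂ[X]) ^ (p + q + 1) ∣ 1 - (1 - (C ε * X) ^ (p + q + 1)) ^ q := by
      have h1 : (X : ℂ[X]) ^ (p + q + 1) ∣ 1 - (1 - (C ε * X) ^ (p + q + 1)) :=
        ⟨C ε ^ (p + q + 1), by ring⟩
      have h2 := sub_dvd_pow_sub_pow (1 : ℂ[X]) (1 - (C ε * X) ^ (p + q + 1)) q
      rw [one_pow] at h2
      exact h1.trans h2
    intro v hv
    rw [hser, ← Polynomial.coe_mul, hprod, Polynomial.coeff_coe]
    have hsplit : P * (1 - (C ε * X) ^ (p + q + 1)) ^ q = P - X ^ (p + q + 1) * (P * W) := by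
      linear_combination (-P) * hW
    rw [hsplit, coeff_sub, coeff_X_pow_mul', if_neg (by omega), sub_zero]

/-- ε ≠ 0 gives the denominator exact degree q; the only root it can have, ε⁻¹, is not a root of P.
Kronecker's criterion applies. -/
theorem inD_geomPoly {f : ℂ → ℂ} {P : ℂ[X]} {p q : ℕ} {ε : ℂ} (hP : P.natDegree ≤ p) (hε : ε ≠ 0)
    (hPε : P.eval ε⁻¹ ≠ 0) (hf : ∀ v, taylorCoeff f v = (geomPoly P p q ε).coeff v) :
    InD f p q := by
  refine (isPade_geomPoly hP hf).inD_of_isCoprime ?_ ?_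
  · have : (1 - C ε * X : ℂ[X]).natDegree = 1 := by
      have h1 : (1 - C ε * X : ℂ[X]) = C (-ε) * X + C 1 := by simp; ring
      rw [h1]
      exact natDegree_linear (neg_ne_zero.2 hε)
    rw [natDegree_pow, this, mul_one]
  · refine IsCoprime.pow_left ?_
    have h1 : (1 - C ε * X : ℂ[X]) = C (-ε) * (X - C ε⁻¹) := by
      rw [mul_sub, ← C_mul, neg_mul, mul_inv_cancel₀ hε]
      simp
      ring
    rw [h1, isCoprime_mul_unit_left_left
      (isUnit_C.2 (isUnit_iff_ne_zero.2 (neg_ne_zero.2 hε)))]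
    exact (irreducible_X_sub_C _).coprime_iff_not_dvd.2 fun h => hPε (dvd_iff_isRoot.1 h)

theorem iteratedDeriv_polynomial_eval (P : ℂ[X]) (l : ℕ) :
    iteratedDeriv l (fun z => P.eval z) = fun z => (derivative^[l] P).eval z := by
  induction l with
  | zero => simp
  | succ l ih =>
    rw [iteratedDeriv_succ, ih]
    funext z
    rw [Polynomial.deriv, Function.iterate_succ_apply']

theorem taylorCoeff_polynomial_eval (P : ℂ[X]) (v : ℕ) :
    taylorCoeff (fun z => P.eval z) v = P.coeff v := by
  have hv : (v.factorial : ℂ) ≠ 0 := by exact_mod_cast v.factorial_ne_zero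
  rw [taylorCoeff, iteratedDeriv_polynomial_eval]
  simp only
  rw [← coeff_zero_eq_eval_zero (derivative^[v] P),
    coeff_iterate_derivative, zero_add, Nat.descFactorial_self, nsmul_eq_mul,
    mul_div_cancel_left₀ _ hv]

/-! ### Continuous dependence on parameters -/

/-- A jointly continuous family of holomorphic functions depends continuously on the parameter,
together with all derivatives, uniformly on compact sets. -/
theorem eventually_norm_iteratedDeriv_sub_lt {Y : Type*} [TopologicalSpace Y] {y₀ : Y}
    {R : Y → ℂ → ℂ} {K U : Set ℂ} (hK : IsCompact K) (hU : IsOpen U) (hKU : K ⊆ U)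
    (hcont : ∀ z ∈ U, ContinuousAt (fun x : Y × ℂ => R x.1 x.2) (y₀, z))
    (hdiff : ∀ z ∈ U, ∀ᶠ x : Y × ℂ in 𝓝 (y₀, z), DifferentiableAt ℂ (R x.1) x.2)
    (l : ℕ) {ε : ℝ} (hε : 0 < ε) :
    ∀ᶠ y in 𝓝 y₀, ∀ z ∈ K, ‖iteratedDeriv l (R y) z - iteratedDeriv l (R y₀) z‖ < ε := by
  obtain ⟨δ, hδ, hδU⟩ := hK.exists_cthickening_subset_open hU hKU
  obtain ⟨η, hη, hηε⟩ : ∃ η > 0, (l.factorial : ℝ) * η / (δ / 2) ^ l < ε := by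
    refine ⟨ε / 2 * (δ / 2) ^ l / l.factorial, by positivity, ?_⟩
    have h1 : (l.factorial : ℝ) ≠ 0 := by exact_mod_cast l.factorial_ne_zero
    have h2 : (l.factorial : ℝ) * (ε / 2 * (δ / 2) ^ l / l.factorial) / (δ / 2) ^ l = ε / 2 := by
      field_simp
    rw [h2]
    exact half_lt_self hε
  -- Compactness of the thickened K turns joint continuity into uniform closeness; Cauchy's
  -- estimates at radius δ/2 then treat the derivatives.
  have hclose : ∀ᶠ y in 𝓝 y₀, ∀ z ∈ Metric.cthickening δ K, ‖R y z - R y₀ z‖ < η := by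
    refine hK.cthickening.eventually_forall_of_forall_eventually fun z hz => ?_
    have h1 := hcont z (hδU hz)
    have h2 : Tendsto (fun x : Y × ℂ => R y₀ x.2) (𝓝 (y₀, z)) (𝓝 (R y₀ z)) := by
      refine Tendsto.comp (f := fun x : Y × ℂ => (y₀, x.2)) (g := fun x : Y × ℂ => R x.1 x.2)
        h1 ?_
      exact (continuous_const.prodMk continuous_snd).tendsto (y₀, z)
    have h3 := (h1.sub h2).norm
    have h4 : ‖R (y₀, z).1 (y₀, z).2 - R y₀ z‖ < η := by simpa using hη
    exact h3.eventually_lt_const h4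
  have hd : ∀ᶠ y in 𝓝 y₀, ∀ z ∈ Metric.cthickening δ K, DifferentiableAt ℂ (R y) z :=
    hK.cthickening.eventually_forall_of_forall_eventually fun z hz => hdiff z (hδU hz)
  have hd0 := hd.self_of_nhds
  have hsub : Metric.thickening δ K ⊆ Metric.cthickening δ K := Metric.thickening_subset_cthickening δ K
  filter_upwards [hclose, hd] with y hy hyd z hz
  have hb : Metric.closedBall z (δ / 2) ⊆ Metric.thickening δ K := fun w hw =>
    Metric.mem_thickening_iff.2 ⟨z, hz, (Metric.mem_closedBall.1 hw).trans_lt (half_lt_self hδ)⟩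
  exact (norm_iteratedDeriv_sub_le Metric.isOpen_thickening
    (fun w hw => (hyd w (hsub hw)).differentiableWithinAt)
    (fun w hw => (hd0 w (hsub hw)).differentiableWithinAt) (half_pos hδ) hb
    (fun w hw => (hy w (hsub (hb hw))).le) l).trans_lt hηε

theorem AInf.extDeriv_eqOn_of_eqOn (hΩ : IsOpen Ω) (f : AInf Ω) {U : Set ℂ} (hU : IsOpen U)
    (hΩU : closure Ω ⊆ U) {h : ℂ → ℂ} (hh : DifferentiableOn ℂ h U) (hfh : EqOn f.toFun h Ω)
    (l : ℕ) : EqOn (f.extDeriv l) (iteratedDeriv l h) (closure Ω) := by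
  have h1 : EqOn (f.extDeriv l) (iteratedDeriv l h) Ω := fun z hz =>
    ((f.extDeriv_continuousOn_eqOn l).2 hz).trans
      ((hfh.eventuallyEq_of_mem (hΩ.mem_nhds hz)).iteratedDeriv_eq l)
  have h2 : ContinuousOn (iteratedDeriv l h) (closure Ω) := by
    have h3 : DifferentiableOn ℂ (iteratedDeriv l h) U := by
      induction l with
      | zero => simpa using hh
      | succ l ih =>
        rw [iteratedDeriv_succ]
        refine (ih fun z hz => ?_).deriv hU
        exact ((f.extDeriv_continuousOn_eqOn l).2 hz).trans
          ((hfh.eventuallyEq_of_mem (hΩ.mem_nhds hz)).iteratedDeriv_eq l)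
    exact h3.continuousOn.mono hΩU
  exact h1.of_subset_closure (f.extDeriv_continuousOn_eqOn l).1 h2 subset_closure le_rfl

/-- The restriction of a polynomial to `Ω`. -/
def AInf.ofPolynomial (hΩ : IsOpen Ω) (P : ℂ[X]) : AInf Ω where
  toFun := Ω.indicator fun z => P.eval z
  zero_off z hz := indicator_of_notMem hz _
  holomorphic := P.differentiable.differentiableOn.congr fun z hz => indicator_of_mem hz _
  extends_closure l := by
    refine ⟨fun z => (derivative^[l] P).eval z, (derivative^[l] P).continuous.continuousOn,
      fun z hz => ?_⟩
    rw [← iteratedDeriv_polynomial_eval]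
    exact ((eqOn_indicator.eventuallyEq_of_mem (hΩ.mem_nhds hz)).iteratedDeriv_eq l).symm

theorem AInf.eqOn_ofPolynomial (hΩ : IsOpen Ω) (P : ℂ[X]) :
    EqOn (AInf.ofPolynomial hΩ P).toFun (fun z => P.eval z) Ω :=
  eqOn_indicator

theorem AInf.ofPolynomial_mem_HClosure (hΩ : IsOpen Ω) (P : ℂ[X]) :
    AInf.ofPolynomial hΩ P ∈ HClosure Ω :=
  ⟨univ, fun z => P.eval z, isOpen_univ, subset_univ _, P.differentiable.differentiableOn,
    AInf.eqOn_ofPolynomial hΩ P⟩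

theorem AInf.extDeriv_ofPolynomial (hΩ : IsOpen Ω) (P : ℂ[X]) (l : ℕ) :
    EqOn ((AInf.ofPolynomial hΩ P).extDeriv l) (iteratedDeriv l fun z => P.eval z) (closure Ω) :=
  (AInf.ofPolynomial hΩ P).extDeriv_eqOn_of_eqOn hΩ isOpen_univ (subset_univ _)
    P.differentiable.differentiableOn (AInf.eqOn_ofPolynomial hΩ P) l

theorem AInf.taylorCoeff_ofPolynomial (hΩ : IsOpen Ω) (h0 : (0 : ℂ) ∈ Ω) (P : ℂ[X]) (v : ℕ) :
    taylorCoeff (AInf.ofPolynomial hΩ P).toFun v = P.coeff v := by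
  rw [← taylorCoeff_polynomial_eval, taylorCoeff, taylorCoeff,
    ((AInf.eqOn_ofPolynomial hΩ P).eventuallyEq_of_mem (hΩ.mem_nhds h0)).iteratedDeriv_eq v]

theorem isCompact_closure_inter_closedBall (Ω : Set ℂ) (n : ℕ) :
    IsCompact (closure Ω ∩ Metric.closedBall (0 : ℂ) n) :=
  (isCompact_closedBall (0 : ℂ) n).inter_left isClosed_closure

theorem AInf.tendsto_ofPolynomial (hΩ : IsOpen Ω) {Q : ℂ → ℂ[X]}
    (hQ : Continuous fun x : ℂ × ℂ => (Q x.1).eval x.2) :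
    Tendsto (fun ε => AInf.ofPolynomial hΩ (Q ε)) (𝓝 0) (𝓝 (AInf.ofPolynomial hΩ (Q 0))) := by
  refine AInf.tendsto_of_seminormDist fun l n => ?_
  rw [Metric.tendsto_nhds]
  intro η hη
  filter_upwards [eventually_norm_iteratedDeriv_sub_lt (y₀ := (0 : ℂ))
    (R := fun ε z => (Q ε).eval z) (isCompact_closure_inter_closedBall Ω n) isOpen_univ
    (subset_univ _) (fun z _ => hQ.continuousAt)
    (fun z _ => Eventually.of_forall fun x => (Q x.1).differentiable.differentiableAt) l
    (half_pos hη)] with ε hε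
  rw [Real.dist_0_eq_abs, abs_of_nonneg (AInf.seminormDist_nonneg _ _ l n)]
  refine (AInf.seminormDist_le (half_pos hη).le fun z hz => ?_).trans_lt (half_lt_self hη)
  rw [AInf.extDeriv_ofPolynomial hΩ _ l hz.1, AInf.extDeriv_ofPolynomial hΩ _ l hz.1]
  exact (hε z hz).le

theorem AInf.continuous_taylorCoeff (h0 : (0 : ℂ) ∈ Ω) (v : ℕ) :
    Continuous fun f : AInf Ω => taylorCoeff f.toFun v := by
  have h1 : ∀ f : AInf Ω, taylorCoeff f.toFun v = f.extDeriv v 0 / (v.factorial : ℂ) := fun f => by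
    rw [taylorCoeff, (f.extDeriv_continuousOn_eqOn v).2 h0]
  simp only [h1]
  refine Continuous.div_const ?_ _
  rw [continuous_iff_continuousAt]
  intro f
  rw [ContinuousAt, Metric.tendsto_nhds]
  intro ε hε
  filter_upwards [f.eventually_norm_extDeriv_sub_lt v 0 hε] with g hg
  rw [dist_eq_norm]
  exact hg 0 ⟨subset_closure h0, by simp⟩

theorem AInf.continuous_taylorCoeffInt (h0 : (0 : ℂ) ∈ Ω) (i : ℤ) :
    Continuous fun f : AInf Ω => taylorCoeffInt f.toFun i := by
  unfold taylorCoeffInt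
  split_ifs
  · exact continuous_const
  · exact AInf.continuous_taylorCoeff h0 _

theorem AInf.continuous_hankel (h0 : (0 : ℂ) ∈ Ω) (p q : ℕ) :
    Continuous fun f : AInf Ω => hankel f.toFun p q :=
  continuous_matrix fun _ _ => AInf.continuous_taylorCoeffInt h0 _

theorem AInf.isOpen_inD (h0 : (0 : ℂ) ∈ Ω) (p q : ℕ) :
    IsOpen {f : AInf Ω | InD f.toFun p q} :=
  isOpen_ne.preimage (AInf.continuous_hankel h0 p q).matrix_det

/-- Cramer's rule: the inverse is the adjugate over a determinant that does not vanish at f. -/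
theorem AInf.continuousAt_padeVec (h0 : (0 : ℂ) ∈ Ω) {p q : ℕ} {f : AInf Ω}
    (hf : InD f.toFun p q) (k : Fin q) :
    ContinuousAt (fun g : AInf Ω => padeVec g.toFun p q k) f := by
  have hH := AInf.continuous_hankel h0 p q
  have h1 : ∀ g : AInf Ω, padeVec g.toFun p q k = (hankel g.toFun p q).det⁻¹ *
      ((hankel g.toFun p q).adjugate.mulVec
        fun i => -taylorCoeffInt g.toFun ((p : ℤ) + 1 + (i : ℕ))) k := by
    intro g
    rw [padeVec, Matrix.inv_def, Ring.inverse_eq_inv', Matrix.smul_mulVec, Pi.smul_apply,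
      smul_eq_mul]
  simp only [h1]
  refine ContinuousAt.mul (hH.matrix_det.continuousAt.inv₀ hf) ?_
  refine Continuous.continuousAt ((continuous_apply k).comp
    (hH.matrix_adjugate.matrix_mulVec (continuous_pi fun i => ?_)))
  exact (AInf.continuous_taylorCoeffInt h0 _).neg

theorem AInf.continuousAt_denCoeff (h0 : (0 : ℂ) ∈ Ω) {p q : ℕ} {f : AInf Ω}
    (hf : InD f.toFun p q) (j : ℕ) :
    ContinuousAt (fun g : AInf Ω => denCoeff g.toFun p q j) f := by
  unfold denCoeff
  split_ifs
  · exact continuousAt_const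
  · exact AInf.continuousAt_padeVec h0 hf _
  · exact continuousAt_const

theorem AInf.continuousAt_numCoeff (h0 : (0 : ℂ) ∈ Ω) {p q : ℕ} {f : AInf Ω}
    (hf : InD f.toFun p q) (v : ℕ) :
    ContinuousAt (fun g : AInf Ω => numCoeff g.toFun p q v) f :=
  tendsto_finsetSum _ fun j _ => (AInf.continuousAt_denCoeff h0 hf j).mul
    (AInf.continuous_taylorCoeffInt h0 _).continuousAt

theorem continuousAt_eval_polyOfCoeffs {Y : Type*} [TopologicalSpace Y] {y₀ : Y} {c : Y → ℕ → ℂ}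
    (hc : ∀ j, ContinuousAt (fun y => c y j) y₀) (n : ℕ) (z : ℂ) :
    ContinuousAt (fun x : Y × ℂ => (polyOfCoeffs n (c x.1)).eval x.2) (y₀, z) := by
  simp only [eval_polyOfCoeffs]
  refine tendsto_finsetSum _ fun j _ => ContinuousAt.mul ?_ (by fun_prop)
  exact ContinuousAt.comp (f := fun x : Y × ℂ => x.1) (g := fun y => c y j) (hc j) continuousAt_fst

/-! ### B_F as a countable intersection of open sets -/

/-- The functions with a good Padé approximant of type `[p/q]` on `closure Ω ∩ {|z| ≤ s}`. -/
def PadeNear (Ω : Set ℂ) (s p q : ℕ) : Set (AInf Ω) :=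
  {f | InD f.toFun p q ∧ ∃ (N D : ℂ[X]) (η : ℝ), IsPade f.toFun p q N D ∧
    (∀ z ∈ closure Ω ∩ Metric.closedBall (0 : ℂ) s, D.eval z ≠ 0) ∧ η < 1 / ((s : ℝ) + 1) ∧
    ∀ l ≤ s, ∀ z ∈ closure Ω ∩ Metric.closedBall (0 : ℂ) s,
      ‖iteratedDeriv l (fun z => N.eval z / D.eval z) z - f.extDeriv l z‖ ≤ η}

theorem isOpen_padeNear (h0 : (0 : ℂ) ∈ Ω) (s p q : ℕ) :
    IsOpen (PadeNear Ω s p q) := by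
  rw [isOpen_iff_mem_nhds]
  rintro f ⟨hf, N, D, η, hP, hD, hη, hclose⟩
  obtain ⟨rfl, rfl⟩ := hP.eq_of_inD hf
  have hK := isCompact_closure_inter_closedBall Ω s
  have hDc : ∀ z, ContinuousAt (fun x : AInf Ω × ℂ => (padeDen x.1.toFun p q).eval x.2) (f, z) :=
    fun z => continuousAt_eval_polyOfCoeffs (c := fun g : AInf Ω => denCoeff g.toFun p q)
      (AInf.continuousAt_denCoeff h0 hf) (q + 1) z
  have hNc : ∀ z, ContinuousAt (fun x : AInf Ω × ℂ => (padeNum x.1.toFun p q).eval x.2) (f, z) :=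
    fun z => continuousAt_eval_polyOfCoeffs (c := fun g : AInf Ω => numCoeff g.toFun p q)
      (AInf.continuousAt_numCoeff h0 hf) (p + 1) z
  have hDne : ∀ z, (padeDen f.toFun p q).eval z ≠ 0 →
      ∀ᶠ x : AInf Ω × ℂ in 𝓝 (f, z), (padeDen x.1.toFun p q).eval x.2 ≠ 0 :=
    fun z hz => (hDc z).eventually_ne hz
  have hU : IsOpen {z | (padeDen f.toFun p q).eval z ≠ 0} :=
    isOpen_ne.preimage (padeDen f.toFun p q).continuous
  -- A third of the slack below 1/(s+1): changing the approximant and changing f each cost less than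
  -- κ.
  set κ : ℝ := (1 / ((s : ℝ) + 1) - η) / 3 with hκ
  have hκ0 : 0 < κ := by
    rw [hκ]
    linarith
  have hrat : ∀ᶠ g in 𝓝 f, ∀ l ∈ Finset.range (s + 1),
      ∀ z ∈ closure Ω ∩ Metric.closedBall (0 : ℂ) s,
      ‖iteratedDeriv l (fun z => (padeNum g.toFun p q).eval z / (padeDen g.toFun p q).eval z) z -
        iteratedDeriv l (fun z => (padeNum f.toFun p q).eval z / (padeDen f.toFun p q).eval z) z‖
        < κ := by
    rw [Filter.eventually_all_finset]
    intro l _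
    refine eventually_norm_iteratedDeriv_sub_lt (y₀ := f)
      (R := fun g z => (padeNum g.toFun p q).eval z / (padeDen g.toFun p q).eval z) hK hU hD
      (fun z hz => (hNc z).div (hDc z) hz) (fun z hz => ?_) l hκ0
    filter_upwards [hDne z hz] with x hx
    exact (padeNum x.1.toFun p q).differentiable.differentiableAt.fun_div
      (padeDen x.1.toFun p q).differentiable.differentiableAt hx
  have hext : ∀ᶠ g in 𝓝 f, ∀ l ∈ Finset.range (s + 1),
      ∀ z ∈ closure Ω ∩ Metric.closedBall (0 : ℂ) s, ‖g.extDeriv l z - f.extDeriv l z‖ < κ := by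
    rw [Filter.eventually_all_finset]
    exact fun l _ => f.eventually_norm_extDeriv_sub_lt l s hκ0
  filter_upwards [hrat, hext, (AInf.isOpen_inD h0 p q).mem_nhds hf,
    hK.eventually_forall_of_forall_eventually
      (P := fun (g : AInf Ω) z => (padeDen g.toFun p q).eval z ≠ 0)
      fun z hz => hDne z (hD z hz)] with g h1 h2 h3 h4
  refine ⟨h3, padeNum g.toFun p q, padeDen g.toFun p q, η + 2 * κ, isPade_padeNum_padeDen h3, h4,
    by rw [hκ]; linarith, fun l hl z hz => ?_⟩
  have hl' : l ∈ Finset.range (s + 1) := by simpa [Nat.lt_succ_iff] using hl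
  have e1 := h1 l hl' z hz
  have e2 := h2 l hl' z hz
  have e3 := hclose l hl z hz
  rw [norm_sub_rev] at e2
  have e4 := norm_sub_le_norm_sub_add_norm_sub
    (iteratedDeriv l (fun z => (padeNum g.toFun p q).eval z / (padeDen g.toFun p q).eval z) z)
    (iteratedDeriv l (fun z => (padeNum f.toFun p q).eval z / (padeDen f.toFun p q).eval z) z)
    (g.extDeriv l z)
  have e5 := norm_sub_le_norm_sub_add_norm_sub
    (iteratedDeriv l (fun z => (padeNum f.toFun p q).eval z / (padeDen f.toFun p q).eval z) z)
    (f.extDeriv l z) (g.extDeriv l z)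
  linarith

/-- A diagonal choice: one pair (p,q) for each s already gives a convergent sequence, since every
compact K and order l are covered once s is large. No monotonicity of the pairs is required. -/
theorem BF_eq_iInter (Ω : Set ℂ) (F : Set (ℕ × ℕ)) :
    BF Ω F = ⋂ s : ℕ, ⋃ x ∈ F, PadeNear Ω s x.1 x.2 := by
  ext f
  simp only [mem_iInter, mem_iUnion, exists_prop]
  constructor
  · rintro ⟨p, q, N, D, hpq, hconv⟩ s
    obtain ⟨hD, hunif⟩ := hconv _ inter_subset_left (isCompact_closure_inter_closedBall Ω s)
    have hl : ∀ᶠ m in atTop, ∀ l ∈ Finset.range (s + 1),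
        ∀ z ∈ closure Ω ∩ Metric.closedBall (0 : ℂ) s, dist (f.extDeriv l z)
          (iteratedDeriv l (fun z => (N m).eval z / (D m).eval z) z) < 1 / ((s : ℝ) + 2) := by
      rw [Filter.eventually_all_finset]
      exact fun l _ => Metric.tendstoUniformlyOn_iff.1 (hunif l) _ (by positivity)
    obtain ⟨m, hm1, hm2⟩ := (hD.and hl).exists
    obtain ⟨hF, hin, hP⟩ := hpq m
    refine ⟨(p m, q m), hF, hin, N m, D m, 1 / ((s : ℝ) + 2), hP, hm1, ?_, fun l hl z hz => ?_⟩
    · exact one_div_lt_one_div_of_lt (by positivity) (by linarith)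
    · have := hm2 l (by simpa [Nat.lt_succ_iff] using hl) z hz
      rw [dist_comm, dist_eq_norm] at this
      exact this.le
  · intro h
    choose x hxF hin N D η hP hD hη hclose using h
    refine ⟨fun s => (x s).1, fun s => (x s).2, N, D, fun s => ⟨hxF s, hin s, hP s⟩,
      fun K hKΩ hK => ?_⟩
    obtain ⟨n, hn⟩ : ∃ n : ℕ, ∀ s, n ≤ s → K ⊆ closure Ω ∩ Metric.closedBall (0 : ℂ) s := by
      obtain ⟨r, hr⟩ := hK.isBounded.subset_closedBall (0 : ℂ)
      obtain ⟨n, hn⟩ := exists_nat_ge r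
      exact ⟨n, fun s hs => subset_inter hKΩ (hr.trans (Metric.closedBall_subset_closedBall
        (hn.trans (by exact_mod_cast hs))))⟩
    refine ⟨?_, fun l => ?_⟩
    · filter_upwards [eventually_ge_atTop n] with s hs z hz using hD s z (hn s hs hz)
    · rw [Metric.tendstoUniformlyOn_iff]
      intro ε hε
      filter_upwards [eventually_ge_atTop n, eventually_ge_atTop l,
        (tendsto_one_div_add_atTop_nhds_zero_nat (𝕜 := ℝ)).eventually_lt_const hε]
        with s hs hsl hsε z hz
      rw [dist_comm, dist_eq_norm]
      exact (hclose s l hsl z (hn s hs hz)).trans_lt ((hη s).trans hsε)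

/-! ### Density -/

/-- Polynomials are dense in `H(closure Ω)`. -/
theorem HClosure_subset_closure_polynomials (hΩ : IsOpen Ω) (h0 : (0 : ℂ) ∈ Ω)
    (hconn : IsConnected ((((↑) : ℂ → OnePoint ℂ) '' closure Ω)ᶜ)) :
    HClosure Ω ⊆ closure (range (AInf.ofPolynomial hΩ)) := by
  rintro f ⟨U, h, hU, hΩU, hh, hfh⟩
  have hstep : ∀ n : ℕ, ∃ P : ℂ[X], ∀ l ≤ n, ∀ z ∈ closure Ω ∩ Metric.closedBall (0 : ℂ) n,
      ‖iteratedDeriv l (fun w => P.eval w) z - iteratedDeriv l h z‖ < 1 / ((n : ℝ) + 1) := fun n =>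
    exists_polynomial_iteratedDeriv_lt isClosed_closure hconn ⟨0, subset_closure h0, by simp⟩ hU
      (inter_subset_left.trans hΩU) hh n (by positivity)
  choose P hP using hstep
  refine mem_closure_of_tendsto (f := fun n => AInf.ofPolynomial hΩ (P n)) (b := atTop) ?_
    (Eventually.of_forall fun n => mem_range_self _)
  refine AInf.tendsto_of_seminormDist fun l k => ?_
  refine squeeze_zero' (Eventually.of_forall fun n => AInf.seminormDist_nonneg _ _ l k) ?_
    (tendsto_one_div_add_atTop_nhds_zero_nat (𝕜 := ℝ))
  filter_upwards [eventually_ge_atTop l, eventually_ge_atTop k] with n hl hk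
  refine (AInf.seminormDist_mono _ _ l hk).trans
    (AInf.seminormDist_le (by positivity) fun z hz => ?_)
  rw [AInf.extDeriv_ofPolynomial hΩ _ l hz.1, f.extDeriv_eqOn_of_eqOn hΩ hU hΩU hh hfh l hz.1]
  exact (hP n l hl z hz).le

theorem continuous_eval_geomPoly (P : ℂ[X]) (p q : ℕ) :
    Continuous fun x : ℂ × ℂ => (geomPoly P p q x.1).eval x.2 := by
  have h1 : ∀ x : ℂ × ℂ, (geomPoly P p q x.1).eval x.2 =
      P.eval x.2 * (∑ k ∈ Finset.range (p + q + 1), (x.1 * x.2) ^ k) ^ q := by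
    intro x
    simp [geomPoly, eval_finsetSum]
  simp only [h1]
  have := P.continuous
  fun_prop

theorem geomPoly_zero (P : ℂ[X]) (p q : ℕ) : geomPoly P p q 0 = P := by
  have h1 : ∑ k ∈ Finset.range (p + q + 1), (C (0 : ℂ) * X) ^ k = 1 := by
    rw [Finset.sum_range_succ']
    simp
  rw [geomPoly, h1, one_pow, mul_one]

/-- Near a nonzero polynomial `P` of degree at most `p` there are polynomials in `D_{p,q}` with a
good Padé approximant of type `[p/q]`. -/
theorem eventually_ofPolynomial_mem_padeNear (hΩ : IsOpen Ω) (h0 : (0 : ℂ) ∈ Ω) {P : ℂ[X]}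
    (hP0 : P ≠ 0) {p : ℕ} (hP : P.natDegree ≤ p) (q s : ℕ) :
    ∀ᶠ ε in 𝓝[≠] (0 : ℂ), AInf.ofPolynomial hΩ (geomPoly P p q ε) ∈ PadeNear Ω s p q := by
  have hK := isCompact_closure_inter_closedBall Ω s
  -- As ε → 0 the pole ε⁻¹ escapes to infinity, past the finitely many roots of P.
  have hroots : ∀ᶠ ε in 𝓝[≠] (0 : ℂ), P.eval ε⁻¹ ≠ 0 := by
    have h1 : {z : ℂ | P.eval z ≠ 0} ∈ Bornology.cobounded ℂ := by
      have h2 : {z : ℂ | P.IsRoot z}.Finite := finite_setOfPred_isRoot hP0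
      exact Bornology.isBounded_def.1 h2.isBounded
    exact tendsto_inv₀_nhdsNE_zero.eventually h1
  -- Half the allowed error: the perturbed polynomial and its approximant are each within κ of P.
  set κ : ℝ := 1 / ((s : ℝ) + 2) / 2 with hκ
  have hκ0 : 0 < κ := by positivity
  have hpoly : ∀ᶠ ε in 𝓝 (0 : ℂ), ∀ l ∈ Finset.range (s + 1),
      ∀ z ∈ closure Ω ∩ Metric.closedBall (0 : ℂ) s,
      ‖iteratedDeriv l (fun z => (geomPoly P p q ε).eval z) z -
        iteratedDeriv l (fun z => P.eval z) z‖ < κ := by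
    rw [Filter.eventually_all_finset]
    intro l _
    have := eventually_norm_iteratedDeriv_sub_lt (y₀ := (0 : ℂ))
      (R := fun ε z => (geomPoly P p q ε).eval z) hK isOpen_univ (subset_univ _)
      (fun z _ => (continuous_eval_geomPoly P p q).continuousAt)
      (fun z _ => Eventually.of_forall fun x => (geomPoly P p q x.1).differentiable.differentiableAt)
      l hκ0
    simpa only [geomPoly_zero] using this
  have hden : ∀ (ε z : ℂ), ((1 - C ε * X : ℂ[X]) ^ q).eval z = (1 - ε * z) ^ q := by simp
  have hne : ∀ z : ℂ, ∀ᶠ x : ℂ × ℂ in 𝓝 (0, z), ((1 - C x.1 * X : ℂ[X]) ^ q).eval x.2 ≠ 0 := by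
    intro z
    simp only [hden]
    have hc : Continuous fun x : ℂ × ℂ => (1 - x.1 * x.2) ^ q := by fun_prop
    exact hc.continuousAt.eventually_ne (by simp)
  have hrat : ∀ᶠ ε in 𝓝 (0 : ℂ), ∀ l ∈ Finset.range (s + 1),
      ∀ z ∈ closure Ω ∩ Metric.closedBall (0 : ℂ) s,
      ‖iteratedDeriv l (fun z => P.eval z / ((1 - C ε * X : ℂ[X]) ^ q).eval z) z -
        iteratedDeriv l (fun z => P.eval z) z‖ < κ := by
    rw [Filter.eventually_all_finset]
    intro l _
    have := eventually_norm_iteratedDeriv_sub_lt (y₀ := (0 : ℂ))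
      (R := fun ε z => P.eval z / ((1 - C ε * X : ℂ[X]) ^ q).eval z) hK isOpen_univ
      (subset_univ _) (fun z _ => ?_) (fun z _ => ?_) l hκ0
    · simpa using this
    · refine ContinuousAt.div (P.continuous.comp continuous_snd).continuousAt ?_
        (hne z).self_of_nhds
      simp only [hden]
      fun_prop
    · filter_upwards [hne z] with x hx
      exact P.differentiable.differentiableAt.fun_div (Polynomial.differentiable _).differentiableAt hx
  filter_upwards [hroots, hpoly.filter_mono nhdsWithin_le_nhds, hrat.filter_mono nhdsWithin_le_nhds,
    (hK.eventually_forall_of_forall_eventually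
      (P := fun ε z => ((1 - C ε * X : ℂ[X]) ^ q).eval z ≠ 0)
      fun z _ => hne z).filter_mono nhdsWithin_le_nhds,
    self_mem_nhdsWithin] with ε h1 h2 h3 h4 h5
  have hco := AInf.taylorCoeff_ofPolynomial hΩ h0 (geomPoly P p q ε)
  refine ⟨inD_geomPoly hP h5 h1 hco, P, (1 - C ε * X) ^ q, 1 / ((s : ℝ) + 2),
    isPade_geomPoly hP hco, h4, one_div_lt_one_div_of_lt (by positivity) (by linarith),
    fun l hl z hz => ?_⟩
  have hl' : l ∈ Finset.range (s + 1) := by simpa [Nat.lt_succ_iff] using hl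
  rw [AInf.extDeriv_ofPolynomial hΩ _ l hz.1]
  have e1 := h2 l hl' z hz
  have e2 := h3 l hl' z hz
  rw [norm_sub_rev] at e1
  refine (norm_sub_le_norm_sub_add_norm_sub _ (iteratedDeriv l (fun z => P.eval z) z) _).trans ?_
  linarith

theorem ofPolynomial_mem_closure (hΩ : IsOpen Ω) (h0 : (0 : ℂ) ∈ Ω) {F : Set (ℕ × ℕ)}
    (hF : ∃ s : ℕ → ℕ × ℕ, (∀ m, s m ∈ F) ∧ Tendsto (fun m => (s m).1) atTop atTop) (s : ℕ)
    (P : ℂ[X]) :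
    AInf.ofPolynomial hΩ P ∈ closure ((⋃ x ∈ F, PadeNear Ω s x.1 x.2) ∩ HClosure Ω) := by
  have hnz : ∀ P : ℂ[X], P ≠ 0 →
      AInf.ofPolynomial hΩ P ∈ closure ((⋃ x ∈ F, PadeNear Ω s x.1 x.2) ∩ HClosure Ω) := by
    intro P hP0
    obtain ⟨t, htF, ht⟩ := hF
    obtain ⟨m, hm⟩ := (ht.eventually_ge_atTop P.natDegree).exists
    have h1 := AInf.tendsto_ofPolynomial hΩ (continuous_eval_geomPoly P (t m).1 (t m).2)
    rw [geomPoly_zero] at h1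
    refine mem_closure_of_tendsto (h1.mono_left (nhdsWithin_le_nhds (s := {0}ᶜ))) ?_
    filter_upwards [eventually_ofPolynomial_mem_padeNear hΩ h0 hP0 hm (t m).2 s] with ε hε
    exact ⟨mem_biUnion (htF m) hε, AInf.ofPolynomial_mem_HClosure hΩ _⟩
  by_cases hP0 : P = 0
  -- The zero polynomial is not coprime to a nonconstant denominator, so it is reached as a limit of
  -- nonzero constants.
  · have h1 := AInf.tendsto_ofPolynomial hΩ (Q := fun ε => C ε) (by simpa using continuous_fst)
    have h2 : AInf.ofPolynomial hΩ P = AInf.ofPolynomial hΩ (C 0) := by rw [hP0, C_0]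
    rw [h2, ← closure_closure]
    refine mem_closure_of_tendsto (h1.mono_left (nhdsWithin_le_nhds (s := {0}ᶜ))) ?_
    filter_upwards [self_mem_nhdsWithin] with ε hε
    exact hnz _ (C_ne_zero.2 hε)
  · exact hnz P hP0

end PadeSmooth

end

/-! ### Conclusion by Baire's theorem -/

open PadeSmooth in
theorem theorem3p4 (Ω : Set ℂ) (hΩ : IsOpen Ω) (h0 : (0 : ℂ) ∈ Ω)
    (hconn : IsConnected ((((↑) : ℂ → OnePoint ℂ) '' closure Ω)ᶜ))
    (F : Set (ℕ × ℕ))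
    (hF : ∃ s : ℕ → ℕ × ℕ, (∀ m, s m ∈ F) ∧ Tendsto (fun m => (s m).1) atTop atTop) :
    IsGδ {f : ↥(closure (PadeSmooth.HClosure Ω)) | (f : PadeSmooth.AInf Ω) ∈ PadeSmooth.BF Ω F} ∧
    Dense {f : ↥(closure (PadeSmooth.HClosure Ω)) | (f : PadeSmooth.AInf Ω) ∈ PadeSmooth.BF Ω F} ∧
    (PadeSmooth.BF Ω F).Nonempty := by
  have hcomplete : CompleteSpace (AInf Ω) := AInf.completeSpace hΩ
  have hX : CompleteSpace ↥(closure (HClosure Ω)) := isClosed_closure.completeSpace_coe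
  have hset : {f : ↥(closure (HClosure Ω)) | (f : AInf Ω) ∈ BF Ω F} =
      ⋂ s : ℕ, (fun f : ↥(closure (HClosure Ω)) => (f : AInf Ω)) ⁻¹'
        ⋃ x ∈ F, PadeNear Ω s x.1 x.2 := by
    rw [← preimage_iInter, ← BF_eq_iInter]
    rfl
  have hopen : ∀ s : ℕ, IsOpen ((fun f : ↥(closure (HClosure Ω)) => (f : AInf Ω)) ⁻¹'
      ⋃ x ∈ F, PadeNear Ω s x.1 x.2) := fun s =>
    (isOpen_biUnion fun x _ => isOpen_padeNear h0 s x.1 x.2).preimage continuous_subtype_val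
  have hdense : ∀ s : ℕ, Dense ((fun f : ↥(closure (HClosure Ω)) => (f : AInf Ω)) ⁻¹'
      ⋃ x ∈ F, PadeNear Ω s x.1 x.2) := by
    intro s f
    -- Density in X is tested in the ambient space; the approximating functions lie in `HClosure Ω`,
    -- hence in X.
    rw [closure_subtype]
    have h1 : HClosure Ω ⊆ closure ((⋃ x ∈ F, PadeNear Ω s x.1 x.2) ∩ HClosure Ω) :=
      (HClosure_subset_closure_polynomials hΩ h0 hconn).trans
        (closure_minimal (range_subset_iff.2 (ofPolynomial_mem_closure hΩ h0 hF s))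
          isClosed_closure)
    refine closure_mono ?_ (closure_minimal h1 isClosed_closure f.2)
    rintro g ⟨hg1, hg2⟩
    exact ⟨⟨g, subset_closure hg2⟩, hg1, rfl⟩
  have hD : Dense {f : ↥(closure (HClosure Ω)) | (f : AInf Ω) ∈ BF Ω F} := by
    rw [hset]
    exact dense_iInter_of_isOpen hopen hdense
  have hne : Nonempty ↥(closure (HClosure Ω)) :=
    ⟨⟨_, subset_closure (AInf.ofPolynomial_mem_HClosure hΩ 0)⟩⟩
  refine ⟨?_, hD, ?_⟩
  · rw [hset]
    exact IsGδ.iInter_of_isOpen hopen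
  · obtain ⟨f, hf⟩ := hD.nonempty
    exact ⟨f, hf⟩
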